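/- Let $\mathbb{K}$ be an algebraically closed, trivially valued field, $M$ a lattice, $N=\mathrm{Hom}(M,\mathbb{Z})$, and $m\ge 1$. Let $\sigma\subset N_\mathbb{Q}$ be a pointed polyhedral cone and let $\Delta_0,\dots,\Delta_m$ each be either empty or a polyhedron in $N_\mathbb{Q}$ with tailcone $\sigma=\{v : \Delta_i+v\subseteq\Delta_i\}$, such that $\sum_i\Delta_i\subsetneq\sigma$. For $u\in\sigma^\vee\cap M$ put $\Delta_i(u)=\min_{v\in\Delta_i}\langle v,u\rangle$ ($=\infty$ if $\Delta_i=\emptyset$). Let $e_1,\dots,e_m$ be the standard basis of $\mathbb{Z}^m$, $e_0=-\sum_{i\ge1}e_i$, let $C\subset N_\mathbb{Q}\times\mathbb{Q}^m$ be the cone generated by all $\Delta_i\times e_i$ and $\sigma\times 0$, and let $H$ be a finite generating set of the semigroup $C^\vee\cap(M\times\mathbb{Z}^m)$. Let $L\subset\mathbb{P}^m$ be a line meeting the torus $(\mathbb{K}^*)^m=\{y_0\cdots y_m\neq0\}$ (with coordinates $z_i=y_i/y_0$), $L^\circ=L\cap(\mathbb{K}^*)^m$, and $Q_i=L\cap V(y_i)$.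 Let $$A(L)=\bigoplus_{u\in\sigma^\vee\cap M}H^0\Big(L,\mathcal{O}\big(\textstyle\sum_i\lfloor\Delta_i(u)\rfloor Q_i\big)\Big)\chi^u ,$$ where a coefficient $\infty$ allows poles of any order, and let $X(L)=\mathrm{Spec}\,A(L)$ be embedded in $\mathbb{A}^{H}$ with ideal $J(L)$, the kernel of $\mathbb{K}[x_u\mid u\in H]\to\mathbb{K}[C^\vee\cap(M\times\mathbb{Z}^m)]\to A(L)$, where $x_u\mapsto\chi^u$ and $\chi^{(u,v)}\mapsto (z^v)|_L\,\chi^u$. Let $X(L)^\circ=X(L)\cap(\mathbb{K}^*)^{H}$. For a subvariety $Y$ of a torus with ideal $I$ in the Laurent polynomial ring, $\mathrm{trop}(Y)$ is the set of real weights $w$ such that the initial ideal $\mathrm{in}_w(I)$ (terms of minimal weight) contains no monomial. Then: 1. The linear map $\phi:(N\oplus\mathbb{Z}^m)_\mathbb{R}\to\mathbb{R}^{H}$, $v\mapsto(\langle v,u\rangle)_{u\in H}$, is injective, and $\mathrm{trop}(X(L)^\circ)=\phi\big(N_\mathbb{R}\times\mathrm{trop}(L^\circ)\big)$. 2. In particular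 $\mathrm{trop}(X(L)^\circ)$ is the product of the tropical line $\mathrm{trop}(L^\circ)$ with a linear space of dimension $\mathrm{rank}\,N$: there are a linear subspace $P\subset\mathbb{R}^H$ of dimension $\mathrm{rank}\,N$ and an injective linear map $\psi:\mathbb{R}^m\to\mathbb{R}^H$ with $P\cap\psi(\mathbb{R}^m)=0$ such that $\mathrm{trop}(X(L)^\circ)=P+\psi(\mathrm{trop}(L^\circ))$. 3. Suppose that the points $Q_0,\dots,Q_m$ are pairwise distinct. Then $\mathrm{trop}(L^\circ)$ is the union of the rays $\rho_i=\mathbb{R}_{\ge0}e_i$, $0\le i\le m$, and $\mathrm{trop}(X(L)^\circ)$ is the support of a polyhedral fan, with $\mathrm{in}_w(J(L))$ constant for $w$ in the relative interior of each cone, whose maximal cones are exactly the $m+1$ pairwise distinct cones $C_i=\phi(N_\mathbb{R}\times\rho_i)$, $0\le i\le m$, each of dimension $\mathrm{rank}\,N+1$. -/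

import Mathlib

open scoped Pointwise

namespace SemiCanonical

/-! ## Initial ideals and tropicalization -/

section Tropical

variable {K : Type*} [Field K]

/-- The initial form of `f` with respect to a weight function on exponents:
the sum of the terms of `f` whose exponent has minimal weight. -/
noncomputable def initialForm {G : Type*} (ω : G → ℝ) (f : AddMonoidAlgebra K G) :
    AddMonoidAlgebra K G :=
  open Classical in
  AddMonoidAlgebra.ofCoeff
    (f.coeff.filter fun a => ∀ b ∈ f.coeff.support, ω a ≤ ω b)

/-- The ideal generated by the initial forms of all elements of `I`. -/
noncomputable def initialIdeal {G : Type*} [AddCommMonoid G] (ω : G → ℝ)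
    (I : Ideal (AddMonoidAlgebra K G)) : Ideal (AddMonoidAlgebra K G) :=
  Ideal.span (initialForm ω '' (I : Set (AddMonoidAlgebra K G)))

/-- The Laurent polynomial ring in the variables `x_i`, `i ∈ ι`, over `K`. -/
abbrev Laurent (K : Type*) [Field K] (ι : Type*) := AddMonoidAlgebra K (ι → ℤ)

/-- The weight `w · α` of a Laurent exponent. -/
def laurentWeight {ι : Type*} [Fintype ι] (w : ι → ℝ) (α : ι → ℤ) : ℝ :=
  ∑ i, w i * (α i : ℝ)

/-- The weight `w · α` of the exponent of an ordinary monomial. -/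
def polyWeight {ι : Type*} [Fintype ι] (w : ι → ℝ) (α : ι →₀ ℕ) : ℝ :=
  ∑ i, w i * (α i : ℝ)

/-- Evaluation of Laurent polynomials at a point of the torus `(K^*)^ι`. -/
noncomputable def laurentEval {ι : Type*} [Fintype ι] (x : ι → Kˣ) : Laurent K ι →ₐ[K] K :=
  AddMonoidAlgebra.lift K K (ι → ℤ)
    { toFun := fun α => ((∏ i, x i ^ (Multiplicative.toAdd α i) : Kˣ) : K)
      map_one' := by simp
      map_mul' := fun α β => by
        simp [zpow_add, Finset.prod_mul_distrib] }

/-- The ideal, in the Laurent polynomial ring, of a subset of the torus. -/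
noncomputable def torusIdeal {ι : Type*} [Fintype ι] (Y : Set (ι → Kˣ)) : Ideal (Laurent K ι) :=
  ⨅ x ∈ Y, RingHom.ker (laurentEval x)

/-- The tropicalization (trivial valuation, minimum convention) of a subvariety `Y` of the torus
`(K^*)^ι`: the weights `w` such that the initial ideal of the ideal of `Y` contains no monomial. -/
def trop {ι : Type*} [Fintype ι] (Y : Set (ι → Kˣ)) : Set (ι → ℝ) :=
  {w | ∀ α : ι → ℤ,
    AddMonoidAlgebra.single α (1 : K) ∉ initialIdeal (laurentWeight w) (torusIdeal Y)}

/-- The part in the torus `(K^*)^ι` of the zero locus of an ideal of `K[x_i | i ∈ ι]`. -/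
def torusLocus {ι : Type*} (I : Ideal (MvPolynomial ι K)) : Set (ι → Kˣ) :=
  {x | ∀ f ∈ I, MvPolynomial.eval (fun i => (x i : K)) f = 0}

end Tropical

/-! ## Polyhedral data

The character lattice is `M`; the cocharacter lattice is `N = Hom(M, ℤ)`, written `M →+ ℤ`, and
`N_ℚ = Hom(M, ℚ)`, `N_ℝ = Hom(M, ℝ)`, the pairing with `M` being evaluation. -/

section Polyhedral

/-- A polyhedron: the Minkowski sum of the convex hull of finitely many points and of a
finitely generated cone (by the Minkowski-Weyl theorem, a finite intersection of half-spaces). -/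
def IsPolyhedron {E : Type*} [AddCommGroup E] [Module ℚ E] (Δ : Set E) : Prop :=
  ∃ (F : Finset E) (τ : PointedCone ℚ E), τ.FG ∧ Δ = convexHull ℚ (F : Set E) + (τ : Set E)

/-- The tailcone of `Δ`: all `v` with `Δ + v ⊆ Δ`. -/
def tailcone {E : Type*} [AddCommGroup E] (Δ : Set E) : Set E :=
  {v | ∀ d ∈ Δ, d + v ∈ Δ}

/-- A pointed polyhedral cone `σ` in `N_ℚ` and `m + 1` coefficients `Δ_0, …, Δ_m`, each of which
is empty or a polyhedron with tailcone `σ`, such that the Minkowski sum of the `Δ_i` is strictly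
contained in `σ`. -/
structure PolyhedralData (M : Type*) [AddCommGroup M] (m : ℕ) where
  σ : PointedCone ℚ (M →+ ℚ)
  σ_polyhedral : σ.FG
  σ_pointed : (σ : ConvexCone ℚ (M →+ ℚ)).Salient
  Δ : Fin (m + 1) → Set (M →+ ℚ)
  polyhedron : ∀ i, Δ i = ∅ ∨ (IsPolyhedron (Δ i) ∧ tailcone (Δ i) = (σ : Set (M →+ ℚ)))
  sum_ssubset : ∑ i, Δ i ⊂ (σ : Set (M →+ ℚ))

/-- The vectors `e_1, …, e_m` (standard basis) and `e_0 = -(e_1 + ⋯ + e_m)`. -/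
def e (R : Type*) [Ring R] {m : ℕ} : Fin (m + 1) → (Fin m → R) :=
  Fin.cases (fun _ => -1) (fun i => Pi.single i 1)

/-- The pairing of `(N ⊕ ℤ^m)_R` with `M × ℤ^m`. -/
def pairing {R : Type*} [Ring R] {M : Type*} [AddCommGroup M] {m : ℕ}
    (v : (M →+ R) × (Fin m → R)) (u : M × (Fin m → ℤ)) : R :=
  v.1 u.1 + ∑ i, v.2 i * (u.2 i : R)

variable {M : Type*} [AddCommGroup M] {m : ℕ} (D : PolyhedralData M m)

/-- The cone `C` in `N_ℚ × ℚ^m` generated by the `Δ_i × e_i` and `σ × 0`. -/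
def coneC : PointedCone ℚ ((M →+ ℚ) × (Fin m → ℚ)) :=
  PointedCone.hull ℚ ((⋃ i, D.Δ i ×ˢ {e ℚ i}) ∪ ((D.σ : Set (M →+ ℚ)) ×ˢ {0}))

/-- The semigroup `C^∨ ∩ (M × ℤ^m)`. -/
def dualSemigroup : AddSubmonoid (M × (Fin m → ℤ)) where
  carrier := {u | ∀ c ∈ coneC D, 0 ≤ pairing c u}
  zero_mem' := fun c _ => by simp [pairing]
  add_mem' := fun {u u'} hu hu' c hc => by
    have h : pairing c (u + u') = pairing c u + pairing c u' := by
      simp [pairing, mul_add, Finset.sum_add_distrib]; ring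
    rw [h]; exact add_nonneg (hu c hc) (hu' c hc)

/-- `Δ(u) = min_{v ∈ Δ} ⟨v, u⟩`, and `∞` when `Δ` is empty. (The infimum is taken in `ℝ`; for `Δ` a
polyhedron and `u` in the dual of its tailcone it is attained, hence rational.) -/
noncomputable def minValue (Δ : Set (M →+ ℚ)) (u : M) : WithTop ℝ :=
  open Classical in
  if Δ.Nonempty then ((sInf ((fun v : M →+ ℚ => ((v u : ℚ) : ℝ)) '' Δ) : ℝ) : WithTop ℝ) else ⊤

/-- `⌊Δ(u)⌋`, with `⌊∞⌋ = ∞`. -/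
noncomputable def floorValue (Δ : Set (M →+ ℚ)) (u : M) : WithTop ℤ :=
  (minValue Δ u).map Int.floor

end Polyhedral

/-! ## Lines in projective space -/

section Line

/-- A line `L = ℙ(W)` in `ℙ^m` meeting the torus, where `W` is a two-dimensional subspace of
`K^(m+1)`. The basis `b` of `W` identifies `L` with `ℙ^1 = K ∪ {∞}`, the element `t ∈ K`
corresponding to the point `[b_0 + t b_1]` and `∞` to `[b_1]`; accordingly the function field
`K(L)` is the field `K(t)`. -/
structure TorusLine (K : Type*) [Field K] (m : ℕ) where
  W : Submodule K (Fin (m + 1) → K)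
  b : Module.Basis (Fin 2) K W
  meets_torus : ∃ p ∈ W, ∀ i, p i ≠ 0

variable {K : Type*} [Field K] {m : ℕ}

/-- `L° = L ∩ (K^*)^m`, the torus having the coordinates `z_i = y_i / y_0`. -/
def TorusLine.interior (L : TorusLine K m) : Set (Fin m → Kˣ) :=
  {z | (Fin.cons 1 (fun i => (z i : K)) : Fin (m + 1) → K) ∈ L.W}

/-- The restriction of the homogeneous coordinate `y_i` to `L`, in the affine coordinate `t`. -/
noncomputable def TorusLine.coord (L : TorusLine K m) (i : Fin (m + 1)) : Polynomial K :=
  Polynomial.C ((L.b 1 : Fin (m + 1) → K) i) * Polynomial.X +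
    Polynomial.C ((L.b 0 : Fin (m + 1) → K) i)

/-- The point `Q_i` of `L` at which `y_i` vanishes. -/
noncomputable def TorusLine.Q (L : TorusLine K m) (i : Fin (m + 1)) : OnePoint K :=
  open Classical in
  if (L.b 1 : Fin (m + 1) → K) i = 0 then OnePoint.infty
  else ((-(L.b 0 : Fin (m + 1) → K) i / (L.b 1 : Fin (m + 1) → K) i : K) : OnePoint K)

/-- The restriction to `L` of the rational function `z_{i+1} = y_{i+1} / y_0`. -/
noncomputable def TorusLine.z (L : TorusLine K m) (i : Fin m) : RatFunc K :=
  algebraMap (Polynomial K) (RatFunc K) (L.coord i.succ) /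
    algebraMap (Polynomial K) (RatFunc K) (L.coord 0)

/-- The order of vanishing at a point of `ℙ^1 = K ∪ {∞}` of a nonzero rational function. -/
noncomputable def ordAt : OnePoint K → RatFunc K → ℤ
  | none, f => -f.intDegree
  | some a, f => (f.num.rootMultiplicity a : ℤ) - (f.denom.rootMultiplicity a : ℤ)

theorem ordAt_infty (f : RatFunc K) : ordAt OnePoint.infty f = -f.intDegree := rfl

theorem ordAt_coe (a : K) (f : RatFunc K) : ordAt (a : OnePoint K) f =
    (f.num.rootMultiplicity a : ℤ) - (f.denom.rootMultiplicity a : ℤ) := rfl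

theorem ordAt_coe_div (a : K) {p q : Polynomial K} (hp : p ≠ 0) (hq : q ≠ 0) :
    ordAt (a : OnePoint K) (algebraMap _ (RatFunc K) p / algebraMap _ (RatFunc K) q) =
      (p.rootMultiplicity a : ℤ) - (q.rootMultiplicity a : ℤ) := by
  set f : RatFunc K := algebraMap _ (RatFunc K) p / algebraMap _ (RatFunc K) q with hf
  have h : f.num * q = p * f.denom := (RatFunc.num_mul_eq_mul_denom_iff hq).2 hf
  have hf0 : f ≠ 0 := by
    rw [hf]
    exact div_ne_zero (RatFunc.algebraMap_ne_zero hp) (RatFunc.algebraMap_ne_zero hq)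
  have hn : f.num ≠ 0 := RatFunc.num_ne_zero hf0
  have hd : f.denom ≠ 0 := RatFunc.denom_ne_zero f
  have h2 := congrArg (Polynomial.rootMultiplicity a) h
  rw [Polynomial.rootMultiplicity_mul (mul_ne_zero hn hq),
    Polynomial.rootMultiplicity_mul (mul_ne_zero hp hd)] at h2
  rw [ordAt_coe]
  omega

theorem ordAt_mul (Q : OnePoint K) {f g : RatFunc K} (hf : f ≠ 0) (hg : g ≠ 0) :
    ordAt Q (f * g) = ordAt Q f + ordAt Q g := by
  induction Q using OnePoint.rec with
  | infty => simp only [ordAt_infty, RatFunc.intDegree_mul hf hg]; ring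
  | coe a =>
    have hfn := RatFunc.num_ne_zero hf
    have hgn := RatFunc.num_ne_zero hg
    have hfd := RatFunc.denom_ne_zero f
    have hgd := RatFunc.denom_ne_zero g
    have h : f * g = algebraMap _ (RatFunc K) (f.num * g.num) /
        algebraMap _ (RatFunc K) (f.denom * g.denom) := by
      conv_lhs => rw [← RatFunc.num_div_denom f, ← RatFunc.num_div_denom g]
      rw [map_mul, map_mul, div_mul_div_comm]
    rw [h, ordAt_coe_div a (mul_ne_zero hfn hgn) (mul_ne_zero hfd hgd),
      Polynomial.rootMultiplicity_mul (mul_ne_zero hfn hgn),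
      Polynomial.rootMultiplicity_mul (mul_ne_zero hfd hgd), ordAt_coe, ordAt_coe]
    push_cast
    ring

theorem ordAt_C (Q : OnePoint K) (k : K) :
    ordAt Q (algebraMap K (RatFunc K) k) = 0 := by
  rw [RatFunc.algebraMap_eq_C]
  induction Q using OnePoint.rec with
  | infty => simp [ordAt_infty]
  | coe a => simp [ordAt_coe]

theorem ordAt_add (Q : OnePoint K) {f g : RatFunc K} (hf : f ≠ 0) (hg : g ≠ 0)
    (hfg : f + g ≠ 0) : min (ordAt Q f) (ordAt Q g) ≤ ordAt Q (f + g) := by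
  induction Q using OnePoint.rec with
  | infty =>
    have := RatFunc.intDegree_add_le hg hfg
    simp only [ordAt_infty]
    omega
  | coe a =>
    have hfn := RatFunc.num_ne_zero hf
    have hgn := RatFunc.num_ne_zero hg
    have hfd := RatFunc.denom_ne_zero f
    have hgd := RatFunc.denom_ne_zero g
    have h : f + g = algebraMap _ (RatFunc K) (f.num * g.denom + f.denom * g.num) /
        algebraMap _ (RatFunc K) (f.denom * g.denom) := by
      conv_lhs => rw [← RatFunc.num_div_denom f, ← RatFunc.num_div_denom g]
      rw [div_add_div _ _ (RatFunc.algebraMap_ne_zero hfd) (RatFunc.algebraMap_ne_zero hgd)]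
      simp only [map_mul, map_add]
    have hne : f.num * g.denom + f.denom * g.num ≠ 0 := by
      intro h0
      rw [h0, map_zero, zero_div] at h
      exact hfg h
    have hm := Polynomial.rootMultiplicity_add (a := a) hne
    rw [Polynomial.rootMultiplicity_mul (mul_ne_zero hfn hgd),
      Polynomial.rootMultiplicity_mul (mul_ne_zero hfd hgn)] at hm
    rw [h, ordAt_coe_div a hne (mul_ne_zero hfd hgd),
      Polynomial.rootMultiplicity_mul (mul_ne_zero hfd hgd), ordAt_coe, ordAt_coe]
    omega

theorem ordAt_one (Q : OnePoint K) : ordAt Q (1 : RatFunc K) = 0 := by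
  have := ordAt_C Q (1 : K)
  rwa [map_one] at this

theorem ordAt_inv (Q : OnePoint K) {f : RatFunc K} (hf : f ≠ 0) :
    ordAt Q f⁻¹ = -ordAt Q f := by
  have h := ordAt_mul Q hf (inv_ne_zero hf)
  rw [mul_inv_cancel₀ hf, ordAt_one] at h
  omega

theorem ordAt_zpow (Q : OnePoint K) {f : RatFunc K} (hf : f ≠ 0) (n : ℤ) :
    ordAt Q (f ^ n) = n * ordAt Q f := by
  have hnat : ∀ k : ℕ, ordAt Q (f ^ k) = k * ordAt Q f := by
    intro k
    induction k with
    | zero => simp [ordAt_one]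
    | succ k ih => rw [pow_succ, ordAt_mul Q (pow_ne_zero k hf) hf, ih]; push_cast; ring
  obtain ⟨k, rfl | rfl⟩ := n.eq_nat_or_neg
  · rw [zpow_natCast, hnat]
  · rw [zpow_neg, zpow_natCast, ordAt_inv Q (pow_ne_zero k hf), hnat]; ring

theorem ordAt_prod (Q : OnePoint K) {ι : Type*} (s : Finset ι) (f : ι → RatFunc K)
    (hf : ∀ i, f i ≠ 0) : ordAt Q (∏ i ∈ s, f i) = ∑ i ∈ s, ordAt Q (f i) := by
  classical
  induction s using Finset.induction_on with
  | empty => simp [ordAt_one]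
  | insert i s hi ih =>
    rw [Finset.prod_insert hi, Finset.sum_insert hi,
      ordAt_mul Q (hf i) (Finset.prod_ne_zero_iff.2 fun j _ => hf j), ih]

theorem TorusLine.coord_ne_zero (L : TorusLine K m) (i : Fin (m + 1)) : L.coord i ≠ 0 := by
  intro h
  obtain ⟨p, hp, hne⟩ := L.meets_torus
  have h0 : (L.b 0 : Fin (m + 1) → K) i = 0 := by
    have := congrArg (fun q => Polynomial.coeff q 0) h
    simpa [TorusLine.coord] using this
  have h1 : (L.b 1 : Fin (m + 1) → K) i = 0 := by
    have := congrArg (fun q => Polynomial.coeff q 1) h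
    simpa [TorusLine.coord] using this
  apply hne i
  have hr := congrArg (fun w : L.W => (w : Fin (m + 1) → K) i) (L.b.sum_repr ⟨p, hp⟩)
  simp only [Fin.sum_univ_two, Submodule.coe_add, Submodule.coe_smul, Pi.add_apply,
    Pi.smul_apply, h0, h1, smul_zero, add_zero] at hr
  exact hr.symm

theorem TorusLine.z_ne_zero (L : TorusLine K m) (i : Fin m) : L.z i ≠ 0 :=
  div_ne_zero (RatFunc.algebraMap_ne_zero (L.coord_ne_zero _))
    (RatFunc.algebraMap_ne_zero (L.coord_ne_zero _))

open Classical in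
theorem TorusLine.ordAt_z (L : TorusLine K m) (P : OnePoint K) (i : Fin m) :
    ordAt P (L.z i) = (if L.Q i.succ = P then 1 else 0) - (if L.Q 0 = P then 1 else 0) := by
  induction P using OnePoint.rec with
  | infty =>
    have hd : ∀ j, ((L.coord j).natDegree : ℤ) = 1 - (if L.Q j = OnePoint.infty then 1 else 0) := by
      intro j
      by_cases hj : (L.b 1 : Fin (m + 1) → K) j = 0
      · simp [TorusLine.coord, TorusLine.Q, hj]
      · simp [TorusLine.coord, TorusLine.Q, hj, Polynomial.natDegree_linear hj]
    have h1 := RatFunc.algebraMap_ne_zero (L.coord_ne_zero i.succ)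
    have h2 := RatFunc.algebraMap_ne_zero (L.coord_ne_zero 0)
    rw [ordAt_infty, TorusLine.z, RatFunc.intDegree_div h1 h2, RatFunc.intDegree_polynomial,
      RatFunc.intDegree_polynomial, hd, hd]
    ring
  | coe a =>
    have hd : ∀ j, ((L.coord j).rootMultiplicity a : ℤ) = if L.Q j = (a : OnePoint K) then 1 else 0 := by
      intro j
      by_cases hj : (L.b 1 : Fin (m + 1) → K) j = 0
      · have hc : L.coord j = Polynomial.C ((L.b 0 : Fin (m + 1) → K) j) := by
          simp [TorusLine.coord, hj]
        have hq : L.Q j = OnePoint.infty := by simp [TorusLine.Q, hj]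
        rw [hc, hq]
        simp
      · set c := (L.b 1 : Fin (m + 1) → K) j with hcdef
        set d := (L.b 0 : Fin (m + 1) → K) j with hddef
        have hq : L.Q j = ((-d / c : K) : OnePoint K) := by
          simp only [TorusLine.Q, ← hcdef, ← hddef, if_neg hj]
        have hc : L.coord j = Polynomial.C c * (Polynomial.X - Polynomial.C (-d / c)) := by
          rw [TorusLine.coord, ← hcdef, ← hddef, mul_sub, ← Polynomial.C_mul,
            mul_div_cancel₀ _ hj, Polynomial.C_neg, sub_neg_eq_add]
        rw [hq, hc, Polynomial.rootMultiplicity_mul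
          (mul_ne_zero (Polynomial.C_ne_zero.2 hj) (Polynomial.X_sub_C_ne_zero _)),
          Polynomial.rootMultiplicity_C, Polynomial.rootMultiplicity_X_sub_C]
        by_cases hh : a = -d / c
        · simp [hh]
        · have hh' : ¬ (-d / c = a) := fun h => hh h.symm
          simp only [OnePoint.coe_eq_coe, if_neg hh, if_neg hh']
          simp
    rw [TorusLine.z, ordAt_coe_div a (L.coord_ne_zero _) (L.coord_ne_zero _), hd, hd]

end Line

/-! ## The variety `X(L)` and its embedding -/

section Embedding

variable {K : Type*} [Field K] {M : Type*} [AddCommGroup M] {m : ℕ}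

/-- The coefficient at `P ∈ L` of the divisor `∑ i, ⌊Δ_i(u)⌋ · Q_i`. -/
noncomputable def divisorCoeff (D : PolyhedralData M m) (L : TorusLine K m) (u : M)
    (P : OnePoint K) : WithTop ℤ :=
  open Classical in ∑ i, if L.Q i = P then floorValue (D.Δ i) u else 0

/-- `H^0(L, O(∑ i, ⌊Δ_i(u)⌋ · Q_i))` as a subspace of the function field; an infinite coefficient
allows poles of any order. -/
noncomputable def sections (D : PolyhedralData M m) (L : TorusLine K m) (u : M) :
    Submodule K (RatFunc K) where
  carrier := {f | f = 0 ∨ ∀ P, ((-ordAt P f : ℤ) : WithTop ℤ) ≤ divisorCoeff D L u P}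
  zero_mem' := Or.inl rfl
  add_mem' := by
    rintro f g (rfl | hf) (rfl | hg)
    · left; simp
    · right; simpa using hg
    · right; simpa using hf
    · by_cases hf0 : f = 0
      · subst hf0; right; simpa using hg
      by_cases hg0 : g = 0
      · subst hg0; right; simpa using hf
      by_cases h0 : f + g = 0
      · left; exact h0
      right
      intro P
      have h := ordAt_add P hf0 hg0 h0
      rcases le_total (ordAt P f) (ordAt P g) with hle | hle
      · rw [min_eq_left hle] at h
        exact le_trans (by exact_mod_cast neg_le_neg h) (hf P)
      · rw [min_eq_right hle] at h
        exact le_trans (by exact_mod_cast neg_le_neg h) (hg P)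
  smul_mem' := by
    rintro k f (rfl | hf)
    · left; simp
    · by_cases hk : k = 0
      · left; simp [hk]
      by_cases hf0 : f = 0
      · left; simp [hf0]
      right
      intro P
      have hk' : algebraMap K (RatFunc K) k ≠ 0 := by simpa using hk
      rw [Algebra.smul_def, ordAt_mul P hk' hf0, ordAt_C P k, zero_add]
      exact hf P

/-- `u ∈ σ^∨`. -/
def InDual (D : PolyhedralData M m) (u : M) : Prop := ∀ s ∈ D.σ, 0 ≤ s u

theorem bddBelow_of_inDual (D : PolyhedralData M m) (i : Fin (m + 1)) {u : M} (hu : InDual D u) :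
    BddBelow ((fun v : M →+ ℚ => ((v u : ℚ) : ℝ)) '' D.Δ i) := by
  rcases D.polyhedron i with h | ⟨⟨F, τ, -, hF⟩, ht⟩
  · rw [h]; simp
  · have hτ : ∀ s ∈ τ, 0 ≤ s u := by
      intro s hs
      apply hu
      have : s ∈ tailcone (D.Δ i) := by
        intro d hd
        rw [hF] at hd ⊢
        obtain ⟨x, hx, y, hy, rfl⟩ := hd
        exact ⟨x, hx, y + s, add_mem hy hs, (add_assoc x y s).symm⟩
      rw [ht] at this
      exact this
    let ev : (M →+ ℚ) →ₗ[ℚ] ℚ :=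
      { toFun := fun v => v u, map_add' := fun _ _ => rfl, map_smul' := fun _ _ => rfl }
    have hfin : (((fun v : M →+ ℚ => v u) '' (F : Set (M →+ ℚ)))).Finite :=
      F.finite_toSet.image _
    obtain ⟨c, hc⟩ := hfin.bddBelow
    have hconv : convexHull ℚ (F : Set (M →+ ℚ)) ⊆ {v | c ≤ v u} := by
      apply convexHull_min
      · intro v hv
        exact hc ⟨v, hv, rfl⟩
      · exact convex_halfSpace_ge ev.isLinear c
    refine ⟨(c : ℝ), ?_⟩
    rintro _ ⟨v, hv, rfl⟩
    rw [hF] at hv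
    obtain ⟨x, hx, y, hy, rfl⟩ := hv
    have h1 : c ≤ x u := hconv hx
    have h2 := hτ y hy
    have h3 : c ≤ (x + y) u := by
      rw [AddMonoidHom.add_apply]; linarith
    have h4 : (c : ℝ) ≤ (((x + y) u : ℚ) : ℝ) := by exact_mod_cast h3
    exact h4

theorem floorValue_add (D : PolyhedralData M m) (i : Fin (m + 1)) {u u' : M}
    (hu : InDual D u) (hu' : InDual D u') :
    floorValue (D.Δ i) u + floorValue (D.Δ i) u' ≤ floorValue (D.Δ i) (u + u') := by
  unfold floorValue minValue
  by_cases h : (D.Δ i).Nonempty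
  · simp only [if_pos h, WithTop.map_coe]
    rw [← WithTop.coe_add, WithTop.coe_le_coe]
    refine le_trans (Int.le_floor_add _ _) (Int.floor_le_floor ?_)
    apply le_csInf (h.image _)
    rintro _ ⟨v, hv, rfl⟩
    have h1 := csInf_le (bddBelow_of_inDual D i hu) ⟨v, hv, rfl⟩
    have h2 := csInf_le (bddBelow_of_inDual D i hu') ⟨v, hv, rfl⟩
    simp only at h1 h2
    simp only [map_add, Rat.cast_add]
    linarith
  · simp [if_neg h]

theorem sections_mul (D : PolyhedralData M m) (L : TorusLine K m) {u u' : M}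
    (hu : InDual D u) (hu' : InDual D u') {f g : RatFunc K} (hf : f ∈ sections D L u)
    (hg : g ∈ sections D L u') : f * g ∈ sections D L (u + u') := by
  by_cases hf0 : f = 0
  · subst hf0; rw [zero_mul]; exact zero_mem _
  by_cases hg0 : g = 0
  · subst hg0; rw [mul_zero]; exact zero_mem _
  right
  intro P
  have hf' := (hf.resolve_left hf0) P
  have hg' := (hg.resolve_left hg0) P
  rw [ordAt_mul P hf0 hg0, neg_add, WithTop.coe_add]
  refine le_trans (add_le_add hf' hg') ?_
  unfold divisorCoeff
  rw [← Finset.sum_add_distrib]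
  refine Finset.sum_le_sum fun i _ => ?_
  split_ifs
  · exact floorValue_add D i hu hu'
  · simp

theorem floorValue_zero (D : PolyhedralData M m) (i : Fin (m + 1)) :
    0 ≤ floorValue (D.Δ i) (0 : M) := by
  unfold floorValue minValue
  by_cases h : (D.Δ i).Nonempty
  · simp only [if_pos h, WithTop.map_coe]
    rw [← WithTop.coe_zero, WithTop.coe_le_coe, Int.floor_nonneg]
    apply le_csInf (h.image _)
    rintro _ ⟨v, hv, rfl⟩
    simp
  · simp [if_neg h]

/-- The ring `A(L)`, the direct sum over `u ∈ σ^∨ ∩ M` of the spaces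
`H^0(L, O(∑ i, ⌊Δ_i(u)⌋ · Q_i)) · χ^u`, as a subring of `K(L)[M]`. -/
noncomputable def ringA (D : PolyhedralData M m) (L : TorusLine K m) :
    Subalgebra K (AddMonoidAlgebra (RatFunc K) M) where
  carrier := {F | ∀ u, F.coeff u ∈ sections D L u ∧ (F.coeff u ≠ 0 → InDual D u)}
  add_mem' := by
    intro F G hF hG u
    rw [AddMonoidAlgebra.coeff_add, Finsupp.add_apply]
    refine ⟨add_mem (hF u).1 (hG u).1, fun h => ?_⟩
    by_cases hFu : F.coeff u = 0
    · exact (hG u).2 fun h0 => h (by rw [hFu, h0, add_zero])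
    · exact (hF u).2 hFu
  mul_mem' := by
    intro F G hF hG u
    have key : (F * G).coeff u ∈ sections D L u ∧ ((F * G).coeff u ≠ 0 →
        ∃ a ∈ F.coeff.support, ∃ b ∈ G.coeff.support, a + b = u) := by
      constructor
      · classical
        rw [AddMonoidAlgebra.mul_def, Finsupp.sum, AddMonoidAlgebra.coeff_sum,
          Finsupp.finsetSum_apply]
        refine sum_mem fun a ha => ?_
        rw [Finsupp.sum, AddMonoidAlgebra.coeff_sum, Finsupp.finsetSum_apply]
        refine sum_mem fun b hb => ?_
        rw [AddMonoidAlgebra.coeff_single, Finsupp.single_apply]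
        split_ifs with hab
        · rw [← hab]
          exact sections_mul D L ((hF a).2 (Finsupp.mem_support_iff.1 ha))
            ((hG b).2 (Finsupp.mem_support_iff.1 hb)) (hF a).1 (hG b).1
        · exact zero_mem _
      · classical
        intro h
        have := AddMonoidAlgebra.support_coeff_mul_subset F G (Finsupp.mem_support_iff.2 h)
        obtain ⟨a, ha, b, hb, hab⟩ := Finset.mem_add.1 this
        exact ⟨a, ha, b, hb, hab⟩
    refine ⟨key.1, fun h => ?_⟩
    obtain ⟨a, ha, b, hb, rfl⟩ := key.2 h
    intro s hs
    rw [map_add]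
    exact add_nonneg ((hF a).2 (Finsupp.mem_support_iff.1 ha) s hs)
      ((hG b).2 (Finsupp.mem_support_iff.1 hb) s hs)
  algebraMap_mem' := by
    classical
    intro k u
    have hc : (algebraMap K (AddMonoidAlgebra (RatFunc K) M) k).coeff u =
        if (0 : M) = u then algebraMap K (RatFunc K) k else 0 := by
      rw [AddMonoidAlgebra.coe_algebraMap]
      simp [AddMonoidAlgebra.coeff_single, Finsupp.single_apply]
    rw [hc]
    split_ifs with hu
    · subst hu
      refine ⟨?_, fun _ s _ => by simp⟩
      by_cases hk : k = 0
      · left; simp [hk]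
      · right
        intro P
        rw [ordAt_C P k, neg_zero]
        unfold divisorCoeff
        refine Finset.sum_nonneg fun i _ => ?_
        split_ifs
        · exact floorValue_zero D i
        · exact le_rfl
    · exact ⟨zero_mem _, fun h => absurd rfl h⟩

/-- The restriction to `L` of the Laurent monomial `z^v`. -/
noncomputable def TorusLine.zpow (L : TorusLine K m) (v : Fin m → ℤ) : RatFunc K :=
  ∏ i, L.z i ^ v i

theorem pairing_e (d : M →+ ℚ) (i : Fin (m + 1)) (u : M × (Fin m → ℤ)) :
    pairing (d, e ℚ i) u =
      d u.1 + (((Fin.cases (-∑ j, u.2 j) u.2 i : ℤ)) : ℚ) := by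
  refine Fin.cases ?_ (fun j => ?_) i
  · simp [pairing, e]
  · simp [pairing, e, Pi.single_apply]

theorem inDual_of_mem (D : PolyhedralData M m) {u : M × (Fin m → ℤ)}
    (hu : u ∈ dualSemigroup D) : InDual D u.1 := by
  intro s hs
  have h : 0 ≤ pairing (s, (0 : Fin m → ℚ)) u :=
    hu _ (Submodule.subset_span (Or.inr ⟨hs, rfl⟩))
  simpa [pairing] using h

theorem zpow_mem (D : PolyhedralData M m) (L : TorusLine K m) {u : M × (Fin m → ℤ)}
    (hu : u ∈ dualSemigroup D) : L.zpow u.2 ∈ sections D L u.1 := by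
  classical
  right
  intro P
  let a : Fin (m + 1) → ℤ := Fin.cases (-∑ j, u.2 j) u.2
  have hord : -ordAt P (L.zpow u.2) = ∑ i, if L.Q i = P then -a i else 0 := by
    rw [TorusLine.zpow, ordAt_prod P _ _ fun i => zpow_ne_zero _ (L.z_ne_zero i)]
    simp only [ordAt_zpow P (L.z_ne_zero _), L.ordAt_z P]
    rw [Fin.sum_univ_succ]
    have h0 : a 0 = -∑ j, u.2 j := rfl
    have hs : ∀ j : Fin m, a j.succ = u.2 j := fun j => rfl
    simp only [h0, hs, mul_sub, Finset.sum_sub_distrib]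
    have h3 : ∀ j : Fin m, (if L.Q j.succ = P then -u.2 j else 0) =
        -(u.2 j * if L.Q j.succ = P then 1 else 0) := by
      intro j
      split_ifs <;> simp
    simp only [h3, Finset.sum_neg_distrib]
    by_cases hq : L.Q 0 = P
    · simp only [hq, if_true, mul_one]
      ring
    · simp only [hq, if_false, mul_zero, Finset.sum_const_zero]
      ring
  have hcoe : ((∑ i, if L.Q i = P then -a i else 0 : ℤ) : WithTop ℤ) =
      ∑ i, if L.Q i = P then ((-a i : ℤ) : WithTop ℤ) else 0 := by
    rw [WithTop.coe_sum]
    refine Finset.sum_congr rfl fun i _ => ?_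
    split_ifs <;> rfl
  rw [hord, hcoe]
  unfold divisorCoeff
  refine Finset.sum_le_sum fun i _ => ?_
  split_ifs
  · unfold floorValue minValue
    by_cases h : (D.Δ i).Nonempty
    · simp only [if_pos h, WithTop.map_coe]
      rw [WithTop.coe_le_coe, Int.le_floor]
      apply le_csInf (h.image _)
      rintro _ ⟨d, hd, rfl⟩
      have hp : 0 ≤ pairing (d, e ℚ i) u :=
        hu _ (Submodule.subset_span (Or.inl (Set.mem_iUnion.2 ⟨i, hd, rfl⟩)))
      rw [pairing_e] at hp
      have : ((-a i : ℤ) : ℚ) ≤ d u.1 := by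
        push_cast
        change -((Fin.cases (-∑ j, u.2 j) u.2 i : ℤ) : ℚ) ≤ d u.1
        linarith
      have h4 : ((-a i : ℤ) : ℝ) ≤ ((d u.1 : ℚ) : ℝ) := by exact_mod_cast this
      exact h4
    · simp [if_neg h]
  · exact le_rfl

/-- The ring `A(C) = K[C^∨ ∩ (M × ℤ^m)]`. -/
abbrev ringAC (K : Type*) [Field K] (D : PolyhedralData M m) :=
  AddMonoidAlgebra K (dualSemigroup D)

/-- The map `A(C) → A(L)` given by restriction of sections to `L`: the monomial
`χ^(u,v) = z^v · χ^u` goes to `z^v|_L · χ^u`. -/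
noncomputable def restrictionMap (D : PolyhedralData M m) (L : TorusLine K m) :
    ringAC K D →ₐ[K] ringA D L :=
  AddMonoidAlgebra.lift K (ringA D L) (dualSemigroup D)
    { toFun := fun u =>
        ⟨AddMonoidAlgebra.single (Multiplicative.toAdd u).1.1
            (L.zpow (Multiplicative.toAdd u).1.2), by
          classical
          intro w
          rw [AddMonoidAlgebra.coeff_single, Finsupp.single_apply]
          split_ifs with h
          · rw [← h]
            exact ⟨zpow_mem D L (Multiplicative.toAdd u).2,
              fun _ => inDual_of_mem D (Multiplicative.toAdd u).2⟩
          · exact ⟨zero_mem _, fun h => absurd rfl h⟩⟩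
      map_one' := by
        apply Subtype.ext
        simp [TorusLine.zpow, AddMonoidAlgebra.one_def]
      map_mul' := fun u u' => by
        apply Subtype.ext
        simp [TorusLine.zpow, AddMonoidAlgebra.single_mul_single, zpow_add₀ (L.z_ne_zero _),
          Finset.prod_mul_distrib] }

/-- The map `S = K[x_u | u ∈ H] → A(C)` sending `x_u` to `χ^u`, for `H` a generating set of the
semigroup `C^∨ ∩ (M × ℤ^m)`. -/
noncomputable def generatorMap (K : Type*) [Field K] (D : PolyhedralData M m)
    (H : Finset (M × (Fin m → ℤ)))
    (hH : AddSubmonoid.closure (H : Set (M × (Fin m → ℤ))) = dualSemigroup D) :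
    MvPolynomial H K →ₐ[K] ringAC K D :=
  MvPolynomial.aeval fun u =>
    AddMonoidAlgebra.single ⟨u.1, hH ▸ AddSubmonoid.subset_closure u.2⟩ 1

/-- The ideal `J(L)` in `S` of `X(L) = Spec A(L)` under the embedding in affine space. -/
noncomputable def idealJ (D : PolyhedralData M m) (L : TorusLine K m)
    (H : Finset (M × (Fin m → ℤ)))
    (hH : AddSubmonoid.closure (H : Set (M × (Fin m → ℤ))) = dualSemigroup D) :
    Ideal (MvPolynomial H K) :=
  RingHom.ker ((restrictionMap D L).comp (generatorMap K D H hH))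

/-- `X(L)° = X(L) ∩ (K^*)^n`, where `n` is the cardinality of `H`. -/
def interiorX (D : PolyhedralData M m) (L : TorusLine K m) (H : Finset (M × (Fin m → ℤ)))
    (hH : AddSubmonoid.closure (H : Set (M × (Fin m → ℤ))) = dualSemigroup D) :
    Set (H → Kˣ) :=
  torusLocus (idealJ D L H hH)

/-- The linear map `φ : (N ⊕ ℤ^m)_ℝ → ℝ^H`, `v ↦ (⟨v, u⟩)_{u ∈ H}`. -/
def tropMap (H : Finset (M × (Fin m → ℤ))) :
    ((M →+ ℝ) × (Fin m → ℝ)) →ₗ[ℝ] (H → ℝ) where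
  toFun v := fun u => pairing v u.1
  map_add' v w := by
    ext u
    simp [pairing, add_mul, Finset.sum_add_distrib]; ring
  map_smul' c v := by
    ext u
    simp [pairing, mul_add, Finset.mul_sum, mul_assoc]

end Embedding

/-! ## Fans -/

section Fan

/-- A (polyhedral) fan: a finite collection of finitely generated cones which contains every face
of each of its members and such that any two members intersect in a common face. -/
structure IsFan {E : Type*} [AddCommGroup E] [Module ℝ E] (Φ : Set (PointedCone ℝ E)) : Prop where
  finite : Φ.Finite
  polyhedral : ∀ c ∈ Φ, c.FG
  face_mem : ∀ c ∈ Φ, ∀ F : PointedCone ℝ E, F.IsFaceOf c → F ∈ Φ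
  inter_face : ∀ c ∈ Φ, ∀ d ∈ Φ, (c ⊓ d).IsFaceOf c ∧ (c ⊓ d).IsFaceOf d

/-- The ray `ρ_i` in `ℝ^m` generated by `e_i`. -/
def ray {m : ℕ} (i : Fin (m + 1)) : PointedCone ℝ (Fin m → ℝ) :=
  PointedCone.hull ℝ {e ℝ i}

/-- The cone `C_i = φ(N_ℝ × ρ_i)`. -/
def tropCone {M : Type*} [AddCommGroup M] {m : ℕ} (H : Finset (M × (Fin m → ℤ)))
    (i : Fin (m + 1)) : PointedCone ℝ (H → ℝ) :=
  ((ray i).comap (LinearMap.snd ℝ (M →+ ℝ) (Fin m → ℝ))).map (tropMap H)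

end Fan

end SemiCanonical

/-! Grade the Laurent polynomials in the `x_h`, `h ∈ H`, by `M`. Since `H` generates `M × ℤ^m` as a
group, `exponentHom H : ℤ^H → M × ℤ^m` is onto, and a Laurent polynomial `f` has for each `u ∈ M` a
slice `f_u`, a Laurent polynomial in `z_1, …, z_m`. The map to `A(L) ⊆ K(L)[M]` sends `f` to `∑
f_u|_L χ^u`, so `f` lies in the ideal of `X(L)°` exactly when every `f_u` lies in the ideal of `L°`
(`mem_torusIdeal_interiorX`, `TorusLine.mem_torusIdeal_interior`).

Generation of the lattice is where the polyhedral hypotheses enter. If the generators of `C` had a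
nontrivial nonnegative relation, then either `σ` would not be pointed or the sum of the `Δ_i` would
be all of `σ` (`relation_eq_zero`). So `C` is pointed, Gordan's theorem gives a lattice point
positive on all its generators, and adding a large multiple of it moves any lattice point into `C^∨`
(`closure_dualSemigroup`).

A weight `w` is in the tropicalization iff no `χ^α + (terms of larger weight)` lies in the ideal
(`mem_trop_iff`). The binomials `1 - χ^β` with `β` in the kernel of `exponentHom H` force `w` to
vanish on that kernel, that is, `w = φ(n, y)`. In degree `u` such a weight is `y` shifted by the
constant `n(u)`, so the condition on the slices is precisely that `y ∈ trop(L°)` (`trop_interiorX`).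
The product decomposition follows from injectivity of `φ`.

When the `Q_i` are distinct, `e_i` is the vector of orders of `z_1, …, z_m` at `Q_i`, and the
valuation at `Q_i` shows that `ρ_i ⊆ trop(L°)`. Conversely any two homogeneous coordinates `y_j`,
`y_k` span the linear forms on `L`, so every other one is a combination of them; hence at most one
coordinate has weight above the minimum, which describes the union of the rays.

The fan consists of the half-spaces `C_i` and their common lineality space. The ideal `J(L)` is also
`M`-graded, so its initial ideal at `φ(n, y)` depends only on the order that `y` induces on
exponents, and this does not change when `y` is scaled by a positive factor. -/

namespace SemiCanonical

/-! ### Pointedness of `C` and generation of the lattice by its dual semigroup -/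

/-- Gordan's theorem over `ℚ`: if a finite family of vectors has no nontrivial nonnegative
relation, some linear functional is positive on all of its members. -/
theorem exists_pos_functional {E ι : Type*} [AddCommGroup E] [Module ℚ E] (s : Finset ι) :
    ∀ g : ι → E, (∀ c : ι → ℚ, (∀ i ∈ s, 0 ≤ c i) → ∑ i ∈ s, c i • g i = 0 →
      ∀ i ∈ s, c i = 0) → ∃ f : E →ₗ[ℚ] ℚ, ∀ i ∈ s, 0 < f (g i) := by
  classical
  induction s using Finset.induction_on with
  | empty => exact fun g _ => ⟨0, by simp⟩
  | insert a s ha ih =>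
    intro g hg
    obtain ⟨f, hf⟩ := ih g fun c hc h0 i hi => by
      have h := hg (fun j => if j = a then 0 else c j)
        (fun j hj => by
          rcases eq_or_ne j a with rfl | hne
          · simp
          · simpa [hne] using hc j (Finset.mem_of_mem_insert_of_ne hj hne))
        (by
          rw [Finset.sum_insert ha]
          simp only [if_true, zero_smul, zero_add]
          rw [← h0]
          refine Finset.sum_congr rfl fun j hj => ?_
          rw [if_neg (ne_of_mem_of_not_mem hj ha)]) i (Finset.mem_insert_of_mem hi)
      simpa [ne_of_mem_of_not_mem hi ha] using h
    rcases lt_or_ge 0 (f (g a)) with hpos | hneg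
    · refine ⟨f, fun i hi => ?_⟩
      rcases Finset.mem_insert.1 hi with rfl | hi
      exacts [hpos, hf i hi]
    -- These vectors lie in the kernel of `f`. As `f (g a) ≤ 0`, they are nonnegative combinations
    -- of `g a` and `g i`, so a nonnegative relation among them is one among the original vectors.
    obtain ⟨f', hf'⟩ := ih (fun i => f (g i) • g a - f (g a) • g i) fun c hc h0 => by
      have h := hg (fun j => if j = a then ∑ i ∈ s, c i * f (g i) else c j * -f (g a))
        (fun j hj => by
          rcases eq_or_ne j a with rfl | hne
          · simp only [if_true]
            exact Finset.sum_nonneg fun i hi => mul_nonneg (hc i hi) (hf i hi).le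
          · simp only [if_neg hne]
            exact mul_nonneg (hc j (Finset.mem_of_mem_insert_of_ne hj hne)) (neg_nonneg.2 hneg))
        (by
          rw [Finset.sum_insert ha, if_pos rfl, Finset.sum_smul, ← h0, ← Finset.sum_add_distrib]
          refine Finset.sum_congr rfl fun j hj => ?_
          rw [if_neg (ne_of_mem_of_not_mem hj ha)]
          module) a (Finset.mem_insert_self a s)
      simp only [if_true] at h
      rw [Finset.sum_eq_zero_iff_of_nonneg
        fun i hi => mul_nonneg (hc i hi) (hf i hi).le] at h
      exact fun i hi => (mul_eq_zero.1 (h i hi)).resolve_right (hf i hi).ne'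
    have hg0 : g a ≠ 0 := by
      intro h0
      have h := hg (fun j => if j = a then 1 else 0) (fun j _ => by positivity)
        (by rw [Finset.sum_insert ha, if_pos rfl, h0, smul_zero, zero_add]
            refine Finset.sum_eq_zero fun j hj => ?_
            rw [if_neg (ne_of_mem_of_not_mem hj ha), zero_smul]) a (Finset.mem_insert_self a s)
      simp at h
    -- For empty `s` the functional `f'` says nothing about `g a`, and only `g a ≠ 0` is available.
    rcases s.eq_empty_or_nonempty with rfl | ⟨i₀, hi₀⟩
    · obtain ⟨h, hh⟩ : ∃ h : Module.Dual ℚ E, h (g a) ≠ 0 := by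
        by_contra! hall
        exact hg0 ((Module.forall_dual_apply_eq_zero_iff ℚ _).1 hall)
      rcases lt_or_gt_of_ne hh with hlt | hgt
      · exact ⟨-h, by simpa using hlt⟩
      · exact ⟨h, by simpa using hgt⟩
    simp only [map_sub, map_smul, smul_eq_mul, sub_pos] at hf'
    -- Positivity of `f' + t f` on `g i` bounds `t` from below and positivity on `g a` bounds it
    -- from above. The bounds are compatible by `hf'`. If `f (g a) = 0` there is no upper bound, and
    -- `f' (g a) > 0` comes from `i₀`.
    obtain ⟨t, ht, ht'⟩ := Order.exists_between_finsets (s.image fun i => -f' (g i) / f (g i))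
      (if f (g a) = 0 then ∅ else {f' (g a) / -f (g a)}) (by
        intro x hx y hy
        obtain ⟨i, hi, rfl⟩ := Finset.mem_image.1 hx
        split_ifs at hy with h0
        · simp at hy
        · rw [Finset.mem_singleton.1 hy, div_lt_div_iff₀ (hf i hi)
            (neg_pos.2 (lt_of_le_of_ne hneg h0))]
          nlinarith [hf' i hi])
    refine ⟨f' + t • f, fun i hi => ?_⟩
    simp only [LinearMap.add_apply, LinearMap.smul_apply, smul_eq_mul]
    rcases Finset.mem_insert.1 hi with rfl | hi
    · by_cases h0 : f (g i) = 0
      · have := hf' i₀ hi₀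
        rw [h0, zero_mul] at this
        rw [h0, mul_zero, add_zero]
        exact pos_of_mul_pos_right this (hf i₀ hi₀).le
      · have h1 := ht' _ (by rw [if_neg h0]; exact Finset.mem_singleton_self _)
        rw [lt_div_iff₀ (neg_pos.2 (lt_of_le_of_ne hneg h0))] at h1
        linarith
    · have h1 := ht _ (Finset.mem_image_of_mem _ hi)
      rw [div_lt_iff₀ (hf i hi)] at h1
      linarith

variable {M : Type*} [AddCommGroup M] {m : ℕ}

theorem pairing_add_right {R : Type*} [CommRing R] (v : (M →+ R) × (Fin m → R))
    (u u' : M × (Fin m → ℤ)) : pairing v (u + u') = pairing v u + pairing v u' := by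
  simp [pairing, mul_add, Finset.sum_add_distrib]; ring

/-- Pairing with a fixed `v`, as a homomorphism. -/
def pairingHom {R : Type*} [CommRing R] (v : (M →+ R) × (Fin m → R)) : M × (Fin m → ℤ) →+ R :=
  AddMonoidHom.mk' (pairing v) (pairing_add_right v)

@[simp] theorem pairingHom_apply {R : Type*} [CommRing R] (v : (M →+ R) × (Fin m → R))
    (u : M × (Fin m → ℤ)) : pairingHom v u = pairing v u := rfl

/-- Pairing with a fixed `u`, as a linear map. -/
def pairingLinear {R : Type*} [CommRing R] (u : M × (Fin m → ℤ)) :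
    ((M →+ R) × (Fin m → R)) →ₗ[R] R where
  toFun v := pairing v u
  map_add' v w := by simp [pairing, add_mul, Finset.sum_add_distrib]; ring
  map_smul' c v := by simp [pairing, mul_add, Finset.mul_sum, mul_assoc]

@[simp] theorem pairingLinear_apply {R : Type*} [CommRing R] (u : M × (Fin m → ℤ))
    (v : (M →+ R) × (Fin m → R)) : pairingLinear u v = pairing v u := rfl

theorem eq_sum_smul_coord [Module.Free ℤ M] [Module.Finite ℤ M] {R : Type*} [CommRing R]
    (n : M →+ R) :
    n = ∑ j, n (Module.Free.chooseBasis ℤ M j) • (Int.castAddHom R).comp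
      ((Module.Free.chooseBasis ℤ M).coord j).toAddMonoidHom := by
  ext u
  have h := congrArg n ((Module.Free.chooseBasis ℤ M).sum_repr u)
  rw [map_sum] at h
  rw [← h]
  simp [mul_comm]

/-- Every rational functional is, up to a positive factor, the pairing with a lattice point. -/
theorem exists_pairing_eq_mul [Module.Free ℤ M] [Module.Finite ℤ M]
    (f : ((M →+ ℚ) × (Fin m → ℚ)) →ₗ[ℚ] ℚ) :
    ∃ (u : M × (Fin m → ℤ)) (k : ℚ), 0 < k ∧ ∀ v, pairing v u = k * f v := by
  classical
  let b := Module.Free.chooseBasis ℤ M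
  let c : Module.Free.ChooseBasisIndex ℤ M ⊕ Fin m → ℚ := Sum.elim
    (fun j => f ((Int.castAddHom ℚ).comp (b.coord j).toAddMonoidHom, 0))
    (fun i => f (0, Pi.single i 1))
  obtain ⟨⟨k, hk⟩, hint⟩ := IsLocalization.exist_integer_multiples_of_finite (nonZeroDivisors ℤ) c
  choose a ha using hint
  have hk0 : (k : ℚ) ≠ 0 := by exact_mod_cast nonZeroDivisors.ne_zero hk
  have hf : ∀ v, (k : ℚ) * f v = ∑ j, v.1 (b j) * a (Sum.inl j) + ∑ i, v.2 i * a (Sum.inr i) := by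
    rintro ⟨n, y⟩
    have hy : y = ∑ i, y i • Pi.single i (1 : ℚ) := pi_eq_sum_univ' y
    have hv : ((n, y) : (M →+ ℚ) × (Fin m → ℚ)) =
        ∑ j, n (b j) • ((Int.castAddHom ℚ).comp (b.coord j).toAddMonoidHom, (0 : Fin m → ℚ)) +
        ∑ i, y i • ((0 : M →+ ℚ), (Pi.single i 1 : Fin m → ℚ)) := by
      apply Prod.ext
      · simpa [Prod.fst_sum] using eq_sum_smul_coord n
      · simpa [Prod.snd_sum] using hy
    conv_lhs => rw [hv]
    simp only [map_add, map_sum, map_smul, mul_add, Finset.mul_sum, smul_eq_mul]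
    have h := ha
    simp only [eq_intCast, zsmul_eq_mul, c] at h
    congr 1
    · refine Finset.sum_congr rfl fun j _ => ?_
      rw [h (Sum.inl j), Sum.elim_inl]; ring
    · refine Finset.sum_congr rfl fun j _ => ?_
      rw [h (Sum.inr j), Sum.elim_inr]; ring
  -- The common denominator `k` may be negative, so the lattice point is multiplied by `k` once more
  -- and the factor becomes `k²`.
  refine ⟨(k • ∑ j, a (Sum.inl j) • b j, fun i => k * a (Sum.inr i)), (k : ℚ) * k,
    mul_self_pos.2 hk0, fun v => ?_⟩
  rw [mul_assoc, hf]
  simp only [pairing, map_zsmul, map_sum, zsmul_eq_mul, Int.cast_mul, mul_add, Finset.mul_sum]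
  congr 1 <;> refine Finset.sum_congr rfl fun i _ => by ring

/-- A coefficient contains finitely many points which, together with `σ`, generate it. -/
theorem PolyhedralData.exists_vertices (D : PolyhedralData M m) (i : Fin (m + 1)) :
    ∃ F : Finset (M →+ ℚ), convexHull ℚ (F : Set (M →+ ℚ)) ⊆ D.Δ i ∧
      (∀ d ∈ D.Δ i, ∃ x ∈ convexHull ℚ (F : Set (M →+ ℚ)), ∃ s ∈ D.σ, d = x + s) ∧
      ∀ d ∈ D.Δ i, ∀ s ∈ D.σ, d + s ∈ D.Δ i := by
  rcases D.polyhedron i with h | ⟨⟨F, τ, -, hF⟩, ht⟩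
  · exact ⟨∅, by simp [h]⟩
  · have htail : ∀ d ∈ D.Δ i, ∀ s ∈ D.σ, d + s ∈ D.Δ i := by
      intro d hd s hs
      have : s ∈ tailcone (D.Δ i) := by rw [ht]; exact hs
      exact this d hd
    refine ⟨F, fun x hx => ?_, fun d hd => ?_, htail⟩
    · rw [hF]
      exact ⟨x, hx, 0, τ.zero_mem, add_zero x⟩
    · rw [hF] at hd
      obtain ⟨x, hx, y, hy, rfl⟩ := hd
      refine ⟨x, hx, y, ?_, rfl⟩
      -- The cone in the presentation of the polyhedron is contained in its tailcone, which is `σ`.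
      have : y ∈ tailcone (D.Δ i) := by
        intro d hd
        rw [hF] at hd ⊢
        obtain ⟨x, hx, z, hz, rfl⟩ := hd
        exact ⟨x, hx, z + y, add_mem hz hy, (add_assoc x z y).symm⟩
      rw [ht] at this
      exact this

/-- Consequently a combination of `e_0, …, e_m` vanishes only if all its coefficients are equal. -/
theorem sum_smul_e (R : Type*) [CommRing R] (c : Fin (m + 1) → R) (j : Fin m) :
    (∑ i, c i • e R i) j = c j.succ - c 0 := by
  simp [Fin.sum_univ_succ, e, Finset.sum_apply, Pi.single_apply]
  ring

/-- The generators of `C` admit no nontrivial nonnegative relation: `C` is pointed. -/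
theorem PolyhedralData.relation_eq_zero (D : PolyhedralData M m)
    (F : Fin (m + 1) → Finset (M →+ ℚ))
    (hF : ∀ i, convexHull ℚ (F i : Set (M →+ ℚ)) ⊆ D.Δ i)
    (htail : ∀ i, ∀ d ∈ D.Δ i, ∀ s ∈ D.σ, d + s ∈ D.Δ i)
    (G : Finset (M →+ ℚ)) (hG : ∀ g ∈ G, g ∈ D.σ ∧ g ≠ 0)
    (c : Fin (m + 1) → (M →+ ℚ) → ℚ) (hc : ∀ i, ∀ d ∈ F i, 0 ≤ c i d)
    (c' : (M →+ ℚ) → ℚ) (hc' : ∀ g ∈ G, 0 ≤ c' g)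
    (h1 : ∑ i, ∑ d ∈ F i, c i d • d + ∑ g ∈ G, c' g • g = 0)
    (h2 : ∑ i, (∑ d ∈ F i, c i d) • e ℚ i = 0) :
    (∀ i, ∀ d ∈ F i, c i d = 0) ∧ ∀ g ∈ G, c' g = 0 := by
  classical
  have hsum : ∀ T ⊆ G, ∑ g ∈ T, c' g • g ∈ D.σ := fun T hT => Submodule.sum_mem _ fun g hg =>
    D.σ.smul_mem (hc' g (hT hg)) (hG g (hT hg)).1
  have heq : ∀ i, ∑ d ∈ F i, c i d = ∑ d ∈ F 0, c 0 d := by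
    intro i
    refine Fin.cases rfl (fun j => ?_) i
    have := congrFun h2 j
    rw [sum_smul_e] at this
    exact sub_eq_zero.1 this
  set l := ∑ d ∈ F 0, c 0 d with hl
  have hl0 : l = 0 := by
    by_contra hne
    have hpos : 0 < l := lt_of_le_of_ne (Finset.sum_nonneg (hc 0)) (Ne.symm hne)
    have hmem : ∀ i, l⁻¹ • ∑ d ∈ F i, c i d • d ∈ D.Δ i := by
      intro i
      refine hF i ?_
      rw [← heq i]
      have := Finset.centerMass_mem_convexHull (R := ℚ) (s := (F i : Set (M →+ ℚ))) (F i)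
        (w := c i) (z := id) (hc i) (by rw [heq i]; exact hpos) (fun d hd => hd)
      simpa [Finset.centerMass] using this
    -- The points of `hmem` sum to the negative of an element of `σ`. Adding that element and `t` to
    -- the summand in `Δ_0`, which absorbs `σ`, writes an arbitrary `t ∈ σ` as a sum of points of
    -- the `Δ_i`, contrary to strictness of the inclusion.
    refine D.sum_ssubset.2 fun t ht => ?_
    let s : M →+ ℚ := l⁻¹ • ∑ g ∈ G, c' g • g + t
    have hs : s ∈ D.σ := add_mem (D.σ.smul_mem (inv_pos.2 hpos).le (hsum G subset_rfl)) ht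
    rw [Set.mem_finsetSum]
    refine ⟨fun i => l⁻¹ • ∑ d ∈ F i, c i d • d + if i = 0 then s else 0, fun {i} _ => ?_, ?_⟩
    · beta_reduce
      split_ifs with hi
      · exact htail i _ (hmem i) s hs
      · simpa using hmem i
    · rw [Finset.sum_add_distrib, Finset.sum_ite_eq' Finset.univ (0 : Fin (m + 1)) (fun _ => s),
        if_pos (Finset.mem_univ _), ← Finset.smul_sum]
      change _ + (_ + t) = t
      rw [← add_assoc, ← smul_add, h1, smul_zero, zero_add]
  have hc0 : ∀ i, ∀ d ∈ F i, c i d = 0 := fun i =>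
    (Finset.sum_eq_zero_iff_of_nonneg (hc i)).1 (by rw [heq i, hl0])
  refine ⟨hc0, fun g hg => ?_⟩
  have h3 : ∑ i, ∑ d ∈ F i, c i d • d = 0 := Finset.sum_eq_zero fun i _ =>
    Finset.sum_eq_zero fun d hd => by rw [hc0 i d hd, zero_smul]
  -- What remains is a relation inside `σ`: if `c' g` were nonzero, both `c' g • g` and its negative
  -- would lie in the pointed cone `σ`.
  rw [h3, zero_add, ← Finset.add_sum_erase _ _ hg] at h1
  by_contra hne
  refine D.σ_pointed (c' g • g) ?_ (smul_ne_zero hne (hG g hg).2) ?_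
  · exact D.σ.smul_mem (hc' g hg) (hG g hg).1
  · rw [neg_eq_of_add_eq_zero_right h1]
    exact hsum _ (Finset.erase_subset _ _)

/-- The semigroup `C^∨ ∩ (M × ℤ^m)` generates `M × ℤ^m` as a group. -/
theorem closure_dualSemigroup [Module.Free ℤ M] [Module.Finite ℤ M] (D : PolyhedralData M m) :
    AddSubgroup.closure (dualSemigroup D : Set (M × (Fin m → ℤ))) = ⊤ := by
  classical
  choose F hF hF' htail using D.exists_vertices
  obtain ⟨G, hG⟩ := D.σ_polyhedral
  have hGσ : ∀ g ∈ G, g ∈ D.σ := fun g hg => hG ▸ Submodule.subset_span hg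
  -- Zero is removed from the generators of `σ`, since no functional is positive on it.
  let s : Finset ((Σ _ : Fin (m + 1), (M →+ ℚ)) ⊕ (M →+ ℚ)) :=
    (Finset.univ.sigma F).disjSum (G.erase 0)
  let g : (Σ _ : Fin (m + 1), (M →+ ℚ)) ⊕ (M →+ ℚ) → (M →+ ℚ) × (Fin m → ℚ) :=
    Sum.elim (fun p => (p.2, e ℚ p.1)) (fun n => (n, 0))
  obtain ⟨f, hf⟩ := exists_pos_functional s g fun c hc h0 => by
    have h1 := congrArg Prod.fst h0
    have h2 := congrArg Prod.snd h0
    simp only [s, g, Finset.sum_disjSum, Finset.sum_sigma, Prod.fst_add, Prod.snd_add,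
      Prod.fst_sum, Prod.snd_sum, Sum.elim_inl, Sum.elim_inr, Prod.smul_fst, Prod.smul_snd,
      Prod.fst_zero, Prod.snd_zero, smul_zero, Finset.sum_const_zero, add_zero] at h1 h2
    simp only [← Finset.sum_smul] at h2
    have := D.relation_eq_zero F hF htail (G.erase 0)
      (fun x hx => ⟨hGσ x (Finset.mem_of_mem_erase hx), Finset.ne_of_mem_erase hx⟩)
      (fun i d => c (Sum.inl ⟨i, d⟩)) (fun i d hd => hc _ (by simp [s, hd]))
      (fun x => c (Sum.inr x)) (fun x hx => hc _ (by simpa [s] using hx)) h1 h2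
    rintro (⟨i, d⟩ | x) hi
    · exact this.1 i d (by simpa [s] using hi)
    · exact this.2 x (by simpa [s] using hi)
  obtain ⟨u₀, k, hk, hu₀⟩ := exists_pairing_eq_mul f
  have hpos : ∀ i ∈ s, 0 < pairing (g i) u₀ := fun i hi => by
    rw [hu₀]; exact mul_pos hk (hf i hi)
  have hdual : ∀ u : M × (Fin m → ℤ), (∀ i ∈ s, 0 ≤ pairing (g i) u) → u ∈ dualSemigroup D := by
    intro u hu
    have hσ : ∀ n ∈ D.σ, 0 ≤ n u.1 := by
      intro n hn
      rw [← hG] at hn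
      induction hn using Submodule.span_induction with
      | mem x hx =>
        by_cases hx0 : x = 0
        · simp [hx0]
        · simpa [g, pairing] using hu (Sum.inr x) (by simpa [s, hx0] using hx)
      | zero => simp
      | add x y _ _ hx hy => exact add_nonneg hx hy
      | smul a x _ hx => exact mul_nonneg a.2 hx
    intro x hx
    induction hx using Submodule.span_induction with
    | mem x hx =>
      rcases hx with hx | ⟨hx1, hx2⟩
      · obtain ⟨i, hd, he⟩ := Set.mem_iUnion.1 hx
        obtain ⟨y, hy, n, hn, hyn⟩ := hF' i _ hd
        have hconv : convexHull ℚ (F i : Set (M →+ ℚ)) ⊆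
            {v | -pairing ((0 : M →+ ℚ), e ℚ i) u ≤ v u.1} := by
          apply convexHull_min
          · intro v hv
            have := hu (Sum.inl ⟨i, v⟩) (by simpa [s] using hv)
            simp only [g, Sum.elim_inl, pairing, AddMonoidHom.zero_apply, zero_add,
              Set.mem_ofPred_eq] at this ⊢
            linarith
          · exact convex_halfSpace_ge (f := fun v : M →+ ℚ => v u.1)
              ⟨fun _ _ => rfl, fun _ _ => rfl⟩ _
        have h1 := hconv hy
        have h2 := hσ n hn
        have he' : x.2 = e ℚ i := he
        simp only [pairing, he', hyn, AddMonoidHom.add_apply, AddMonoidHom.zero_apply, zero_add,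
          Set.mem_ofPred_eq] at h1 ⊢
        linarith
      · have hx2' : x.2 = 0 := hx2
        simpa [pairing, hx2'] using hσ _ hx1
    | zero => simp [pairing]
    | add x y _ _ hx hy =>
      have := (pairingLinear u).map_add x y
      simp only [pairingLinear_apply] at this
      rw [this]; exact add_nonneg hx hy
    | smul a x _ hx =>
      have := (pairingLinear u).map_smul (a : ℚ) x
      simp only [pairingLinear_apply] at this
      change 0 ≤ pairing ((a : ℚ) • x) u
      rw [this]; exact mul_nonneg a.2 hx
  have hu₀' : u₀ ∈ dualSemigroup D := hdual u₀ fun i hi => (hpos i hi).le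
  rw [eq_top_iff]
  intro y _
  -- As `u₀` is positive on the finitely many generators, `y + N u₀` lies in the semigroup for large
  -- `N`, and `y` is its difference with `N u₀`.
  obtain ⟨N, hN⟩ : ∃ N : ℕ, ∀ i ∈ s, 0 ≤ pairing (g i) (y + N • u₀) := by
    have : ∀ i ∈ s, ∃ N : ℕ, -pairing (g i) y ≤ N * pairing (g i) u₀ := fun i hi => by
      obtain ⟨N, hN⟩ := Archimedean.arch (-pairing (g i) y) (hpos i hi)
      exact ⟨N, by simpa using hN⟩
    choose! N hN using this
    refine ⟨s.sup N, fun i hi => ?_⟩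
    have h1 := hN i hi
    have h2 : (N i : ℚ) ≤ (s.sup N : ℕ) := by exact_mod_cast Finset.le_sup hi
    rw [← pairingHom_apply, map_add, map_nsmul, pairingHom_apply, pairingHom_apply, nsmul_eq_mul]
    nlinarith [mul_le_mul_of_nonneg_right h2 (hpos i hi).le]
  have := sub_mem (AddSubgroup.subset_closure (hdual _ hN))
    (nsmul_mem (AddSubgroup.subset_closure hu₀') N)
  simpa using this

/-! ### Initial ideals, gradings and monomials -/

section InitialIdeals

variable {K : Type*} [Field K] {G : Type*}

/-- The part of `f` supported on the exponents `a` with `γ a = x`. -/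
noncomputable def component {X : Type*} (γ : G → X) (x : X) :
    AddMonoidAlgebra K G →ₗ[K] AddMonoidAlgebra K G :=
  open Classical in
  { toFun := fun f => AddMonoidAlgebra.ofCoeff (f.coeff.filter fun a => γ a = x)
    map_add' := fun f g => by
      ext a; simp [Finsupp.filter_add]
    map_smul' := fun c f => by
      ext a; simp [Finsupp.filter_smul] }

open Classical in
theorem component_apply {X : Type*} (γ : G → X) (x : X) (f : AddMonoidAlgebra K G) (a : G) :
    (component γ x f).coeff a = if γ a = x then f.coeff a else 0 := by
  simp [component, Finsupp.filter_apply]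

open Classical in
theorem component_single {X : Type*} (γ : G → X) (x : X) (a : G) (c : K) :
    component γ x (AddMonoidAlgebra.single a c) =
      if γ a = x then AddMonoidAlgebra.single a c else 0 := by
  ext b
  rw [component_apply]
  by_cases hb : a = b
  · subst hb; split_ifs <;> simp
  · split_ifs <;> simp [AddMonoidAlgebra.coeff_single, hb]

open Classical in
theorem sum_component {X : Type*} (γ : G → X) (f : AddMonoidAlgebra K G) :
    ∑ x ∈ f.coeff.support.image γ, component γ x f = f := by
  ext a
  rw [AddMonoidAlgebra.coeff_sum, Finsupp.finsetSum_apply]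
  simp only [component_apply]
  rw [Finset.sum_ite_eq]
  split_ifs with h
  · rfl
  · by_contra hne
    exact h (Finset.mem_image_of_mem _ (Finsupp.mem_support_iff.2 (Ne.symm hne)))

open Classical in
theorem initialForm_apply (ω : G → ℝ) (f : AddMonoidAlgebra K G) (a : G) :
    (initialForm ω f).coeff a =
      if ∀ b, f.coeff b ≠ 0 → ω a ≤ ω b then f.coeff a else 0 := by
  simp [initialForm, Finsupp.filter_apply]

/-- Each `γ`-component of the `ω`-initial form of `f ∈ I` is zero or is the `ω'`-initial form of the
same component of `f`, which belongs to `I` because `I` is graded. -/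
theorem initialIdeal_le_of_graded [AddCommMonoid G] {X : Type*} (γ : G → X) {ω ω' : G → ℝ}
    (hω : ∀ a b, γ a = γ b → (ω a ≤ ω b ↔ ω' a ≤ ω' b)) {I : Ideal (AddMonoidAlgebra K G)}
    (hI : ∀ f ∈ I, ∀ x, component γ x f ∈ I) : initialIdeal ω I ≤ initialIdeal ω' I := by
  classical
  rw [initialIdeal, Ideal.span_le]
  rintro _ ⟨f, hf, rfl⟩
  rw [← sum_component γ (initialForm ω f)]
  refine Ideal.sum_mem _ fun x _ => ?_
  by_cases h0 : component γ x (initialForm ω f) = 0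
  · rw [h0]; exact zero_mem _
  obtain ⟨a₀, ha₀⟩ : ∃ a, (component γ x (initialForm ω f)).coeff a ≠ 0 := by
    by_contra! h
    exact h0 (by ext a; simpa using h a)
  rw [component_apply, initialForm_apply] at ha₀
  simp only [ne_eq, ite_eq_right_iff, Classical.not_imp] at ha₀
  obtain ⟨hx, hmin, hfa⟩ := ha₀
  refine Ideal.subset_span ⟨component γ x f, hI f hf x, ?_⟩
  ext a
  rw [component_apply, initialForm_apply, initialForm_apply, component_apply]
  by_cases hax : γ a = x
  · simp only [if_pos hax]
    congr 1
    refine propext ⟨fun h b hb => ?_, fun h b hb => ?_⟩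
    · refine le_trans ((hω a a₀ (hax.trans hx.symm)).2 (h a₀ ?_)) (hmin b hb)
      rwa [component_apply, if_pos hx]
    · rw [component_apply] at hb
      have hbx : γ b = x := by by_contra hn; simp [hn] at hb
      rw [if_pos hbx] at hb
      exact (hω a b (hax.trans hbx.symm)).1 (h b hb)
  · simp [hax]

/-- The initial ideals, with respect to two weights, of an ideal that is graded by `γ`, agree when
the weights order the exponents of each degree in the same way. -/
theorem initialIdeal_eq_of_graded [AddCommMonoid G] {X : Type*} (γ : G → X) {ω ω' : G → ℝ}
    (hω : ∀ a b, γ a = γ b → (ω a ≤ ω b ↔ ω' a ≤ ω' b)) {I : Ideal (AddMonoidAlgebra K G)}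
    (hI : ∀ f ∈ I, ∀ x, component γ x f ∈ I) : initialIdeal ω I = initialIdeal ω' I :=
  le_antisymm (initialIdeal_le_of_graded γ hω hI)
    (initialIdeal_le_of_graded γ (fun a b h => (hω a b h).symm) hI)

theorem component_single_mul [AddCommMonoid G] (ω : G →+ ℝ) (d : ℝ) (a : G) (c : K)
    (f : AddMonoidAlgebra K G) : component ω d (AddMonoidAlgebra.single a c * f) =
      AddMonoidAlgebra.single a c * component ω (d - ω a) f := by
  classical
  induction f using AddMonoidAlgebra.induction_linear with
  | zero => simp
  | add f g hf hg => rw [mul_add, map_add, hf, hg, map_add, mul_add]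
  | single b r =>
    rw [AddMonoidAlgebra.single_mul_single, component_single, component_single, map_add]
    by_cases h : ω a + ω b = d
    · rw [if_pos h, if_pos (by linarith), AddMonoidAlgebra.single_mul_single]
    · rw [if_neg h, if_neg (fun h' => h (by linarith)), mul_zero]

/-- Every homogeneous part of an element of the initial ideal of `I` is zero or the initial form of
an element of `I`. -/
theorem exists_mem_component_eq [AddCommMonoid G] (ω : G →+ ℝ) {I : Ideal (AddMonoidAlgebra K G)}
    {h : AddMonoidAlgebra K G} (hh : h ∈ initialIdeal ω I) :
    ∀ d, ∃ f ∈ I, (∀ b, f.coeff b ≠ 0 → d ≤ ω b) ∧ component ω d f = component ω d h := by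
  classical
  -- Stated separately because additivity is needed twice: for sums in the span, and for decomposing
  -- a multiplier into monomials.
  have hadd : ∀ h₁ h₂ : AddMonoidAlgebra K G,
      (∀ d, ∃ f ∈ I, (∀ b, f.coeff b ≠ 0 → d ≤ ω b) ∧ component ω d f = component ω d h₁) →
      (∀ d, ∃ f ∈ I, (∀ b, f.coeff b ≠ 0 → d ≤ ω b) ∧ component ω d f = component ω d h₂) →
      ∀ d, ∃ f ∈ I, (∀ b, f.coeff b ≠ 0 → d ≤ ω b) ∧
        component ω d f = component ω d (h₁ + h₂) := by
    intro h₁ h₂ H₁ H₂ d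
    obtain ⟨f, hf, hfb, hfd⟩ := H₁ d
    obtain ⟨g, hg, hgb, hgd⟩ := H₂ d
    refine ⟨f + g, add_mem hf hg, fun b hb => ?_, by rw [map_add, map_add, hfd, hgd]⟩
    by_cases h0 : f.coeff b = 0
    · exact hgb b fun h1 => hb (by simp [h0, h1])
    · exact hfb b h0
  induction hh using Submodule.span_induction with
  | mem h hx =>
    obtain ⟨f, hf, rfl⟩ := hx
    intro d
    -- An initial form lives in a single weight: either its part of weight `d` vanishes, or `d` is
    -- the minimal weight of `f` and `f` itself is the witness.
    by_cases h0 : component ω d (initialForm ω f) = 0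
    · exact ⟨0, zero_mem _, by simp, by rw [h0, map_zero]⟩
    obtain ⟨a, ha⟩ : ∃ a, (component ω d (initialForm ω f)).coeff a ≠ 0 := by
      by_contra! h
      exact h0 (by ext a; simpa using h a)
    rw [component_apply, initialForm_apply] at ha
    simp only [ne_eq, ite_eq_right_iff, Classical.not_imp] at ha
    obtain ⟨rfl, hmin, -⟩ := ha
    refine ⟨f, hf, hmin, ?_⟩
    ext b
    rw [component_apply, component_apply, initialForm_apply]
    by_cases hb : ω b = ω a
    · rw [if_pos hb, if_pos hb, if_pos (fun x hx => hb.le.trans (hmin x hx))]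
    · simp [hb]
  | zero => exact fun d => ⟨0, zero_mem _, by simp, rfl⟩
  | add h₁ h₂ _ _ H₁ H₂ => exact hadd h₁ h₂ H₁ H₂
  | smul r h _ H =>
    rw [smul_eq_mul]
    induction r using AddMonoidAlgebra.induction_linear with
    | zero => exact fun d => ⟨0, zero_mem _, by simp, by simp⟩
    | add r s hr hs => rw [add_mul]; exact hadd _ _ hr hs
    | single a c =>
      intro d
      obtain ⟨f, hf, hfb, hfd⟩ := H (d - ω a)
      refine ⟨AddMonoidAlgebra.single a c * f, Ideal.mul_mem_left _ _ hf, fun b hb => ?_, by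
        rw [component_single_mul, component_single_mul, hfd]⟩
      have := AddMonoidAlgebra.support_coeff_mul_subset _ _ (Finsupp.mem_support_iff.2 hb)
      obtain ⟨x, hx, y, hy, rfl⟩ := Finset.mem_add.1 this
      have hxa : x = a := by
        by_contra hne
        simp [AddMonoidAlgebra.coeff_single, Ne.symm hne] at hx
      have := hfb y (Finsupp.mem_support_iff.1 hy)
      rw [map_add, hxa]
      linarith

/-- A monomial lies in the initial ideal of `I` iff it is the initial form of an element of `I`. -/
theorem single_mem_initialIdeal_iff [AddCommMonoid G] (ω : G →+ ℝ)
    {I : Ideal (AddMonoidAlgebra K G)} (α : G) :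
    AddMonoidAlgebra.single α (1 : K) ∈ initialIdeal ω I ↔
      ∃ f : AddMonoidAlgebra K G, (∀ b, f.coeff b ≠ 0 → ω α < ω b) ∧
        AddMonoidAlgebra.single α 1 + f ∈ I := by
  classical
  constructor
  · intro h
    -- In weight `ω α` this `f` has exactly the term `χ^α`, so all its other terms have larger
    -- weight.
    obtain ⟨f, hf, hfb, hfd⟩ := exists_mem_component_eq ω h (ω α)
    refine ⟨f - AddMonoidAlgebra.single α 1, fun b hb => ?_, by simpa using hf⟩
    have hc := congrArg (fun g => g.coeff b) hfd
    simp only [component_apply] at hc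
    rw [AddMonoidAlgebra.coeff_sub, Finsupp.sub_apply] at hb
    by_cases hab : ω b = ω α
    · rw [if_pos hab, if_pos hab] at hc
      exact absurd (sub_eq_zero.2 hc) hb
    · have hne : α ≠ b := fun h => hab (by rw [h])
      rw [AddMonoidAlgebra.coeff_single, Finsupp.single_apply, if_neg hne, sub_zero] at hb
      exact lt_of_le_of_ne (hfb b hb) (Ne.symm hab)
  · rintro ⟨f, hfb, hf⟩
    refine Ideal.subset_span ⟨_, hf, ?_⟩
    have hα : f.coeff α = 0 := by
      by_contra h
      exact lt_irrefl _ (hfb α h)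
    have hle : ∀ b, (AddMonoidAlgebra.single α (1 : K) + f).coeff b ≠ 0 → ω α ≤ ω b := by
      intro b hb
      by_cases hab : α = b
      · rw [hab]
      · refine (hfb b fun h => hb ?_).le
        simp [AddMonoidAlgebra.coeff_single, hab, h]
    ext b
    rw [initialForm_apply]
    by_cases hab : α = b
    · subst hab
      rw [if_pos hle]
      simp [hα]
    · have h1 : (AddMonoidAlgebra.single α (1 : K)).coeff b = 0 := by
        simp [AddMonoidAlgebra.coeff_single, hab]
      rw [h1]
      by_cases hfb0 : f.coeff b = 0
      · have h0 : (AddMonoidAlgebra.single α (1 : K) + f).coeff b = 0 := by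
          rw [AddMonoidAlgebra.coeff_add, Finsupp.add_apply, h1, hfb0, add_zero]
        rw [h0, ite_self]
      · rw [if_neg]
        intro h
        have := h α (by simp [hα])
        exact absurd (hfb b hfb0) (not_lt.2 this)

end InitialIdeals

/-! ### Laurent polynomials on a rationally parametrized curve -/

section TorusPoints

variable {K : Type*} [Field K] {ι : Type*} [Fintype ι]

/-- Evaluation of Laurent polynomials at a point of the torus with values in a `K`-algebra. -/
noncomputable def torusMap {R : Type*} [CommRing R] [Algebra K R] (x : ι → Rˣ) :
    Laurent K ι →ₐ[K] R :=
  AddMonoidAlgebra.lift K R (ι → ℤ)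
    { toFun := fun α => ((∏ i, x i ^ (Multiplicative.toAdd α i) : Rˣ) : R)
      map_one' := by simp
      map_mul' := fun α β => by simp [zpow_add, Finset.prod_mul_distrib] }

theorem torusMap_single {R : Type*} [CommRing R] [Algebra K R] (x : ι → Rˣ) (α : ι → ℤ) (c : K) :
    torusMap x (AddMonoidAlgebra.single α c) = c • ((∏ i, x i ^ α i : Rˣ) : R) := by
  rw [torusMap, AddMonoidAlgebra.lift_single]
  rfl

theorem laurentEval_eq_torusMap (x : ι → Kˣ) : laurentEval x = torusMap x := rfl

theorem map_torusMap {R S : Type*} [CommRing R] [Algebra K R] [CommRing S] [Algebra K S]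
    (φ : R →ₐ[K] S) (x : ι → Rˣ) (y : ι → Sˣ) (hxy : ∀ i, φ (x i) = y i) (f : Laurent K ι) :
    φ (torusMap x f) = torusMap y f := by
  have hy : y = fun i => Units.map (φ : R →* S) (x i) := funext fun i => Units.ext (hxy i).symm
  subst hy
  induction f using AddMonoidAlgebra.induction_linear with
  | zero => simp
  | add f g hf hg => rw [map_add, map_add, hf, hg, map_add]
  | single α c =>
    rw [torusMap_single, torusMap_single, map_smul]
    congr 1
    have := map_prod (Units.map (φ : R →* S)) (fun i => x i ^ α i) Finset.univ
    simp only [map_zpow] at this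
    rw [← this]
    rfl

variable {m : ℕ}

/-- The point of the torus with coordinates `p_{i+1}(s) / p_0(s)`. -/
noncomputable def polyPoint (p : Fin (m + 1) → Polynomial K) (s : K)
    (hs : ∀ i, (p i).eval s ≠ 0) : Fin m → Kˣ :=
  fun i => Units.mk0 _ (hs i.succ) / Units.mk0 _ (hs 0)

/-- The point of the torus with coordinates `p_{i+1} / p_0` in the field of rational functions. -/
noncomputable def ratPoint (p : Fin (m + 1) → Polynomial K) (hp : ∀ i, p i ≠ 0) :
    Fin m → (RatFunc K)ˣ :=
  fun i => Units.mk0 _ (RatFunc.algebraMap_ne_zero (hp i.succ)) /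
    Units.mk0 _ (RatFunc.algebraMap_ne_zero (hp 0))

/-- A Laurent polynomial in rational functions becomes a polynomial after clearing denominators. -/
theorem exists_polynomial_torusMap (p : Fin (m + 1) → Polynomial K) (hp : ∀ i, p i ≠ 0)
    (f : Laurent K (Fin m)) : ∃ (a b : Polynomial K), b ≠ 0 ∧
      algebraMap _ (RatFunc K) b * torusMap (ratPoint p hp) f = algebraMap _ (RatFunc K) a ∧
      ∀ s hs, b.eval s ≠ 0 ∧ b.eval s * torusMap (polyPoint p s hs) f = a.eval s := by
  classical
  set q := ∏ i, p i with hq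
  have hq0 : q ≠ 0 := Finset.prod_ne_zero_iff.2 fun i _ => hp i
  -- Over `K[t]` with all `p_i` inverted the point is universal: the field of rational functions and
  -- every admissible parameter value receive it by specialization, so one numerator and one
  -- denominator serve them all.
  let R := Localization.Away q
  have hunit : ∀ i, IsUnit (algebraMap (Polynomial K) R (p i)) := fun i =>
    isUnit_of_dvd_unit (map_dvd _ (Finset.dvd_prod_of_mem p (Finset.mem_univ i)))
      (IsLocalization.Away.algebraMap_isUnit q)
  let x : Fin m → Rˣ := fun i => (hunit i.succ).unit / (hunit 0).unit
  obtain ⟨⟨a, ⟨_, n, rfl⟩⟩, ha⟩ := IsLocalization.surj (Submonoid.powers q) (torusMap (K := K) x f)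
  have key : ∀ (S : Type _) [Field S] [Algebra K S] (φ : Polynomial K →ₐ[K] S)
      (h : ∀ i, φ (p i) ≠ 0) (y : Fin m → Sˣ)
      (_ : ∀ i, (y i : S) = φ (p i.succ) / φ (p 0)),
      φ (q ^ n) ≠ 0 ∧ φ (q ^ n) * torusMap y f = φ a := by
    intro S _ _ φ h y hy
    have hφq : φ q ≠ 0 := by
      rw [hq, map_prod]; exact Finset.prod_ne_zero_iff.2 fun i _ => h i
    refine ⟨by rw [map_pow]; exact pow_ne_zero n hφq, ?_⟩
    have hφu : ∀ z : Submonoid.powers q, IsUnit (φ z) := by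
      rintro ⟨_, k, rfl⟩
      simpa using (IsUnit.mk0 _ hφq).pow k
    let ψ : R →ₐ[K] S := IsLocalization.liftAlgHom (M := Submonoid.powers q) (f := φ) hφu
    have hψ : ∀ z, ψ (algebraMap _ R z) = φ z := fun z =>
      IsLocalization.lift_eq (M := Submonoid.powers q) (g := (φ : Polynomial K →+* S)) hφu z
    have hx : ∀ i, ψ (x i) = y i := by
      intro i
      rw [hy, ← hψ, ← hψ, eq_div_iff (by rw [hψ]; exact h 0), ← map_mul]
      congr 1
      change _ * ((hunit 0).unit : R) = ((hunit i.succ).unit : R)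
      rw [← Units.val_mul, div_mul_cancel]
    have := congrArg ψ ha
    rw [map_mul, hψ, hψ, map_torusMap ψ x y hx] at this
    rw [mul_comm]
    exact this
  refine ⟨a, q ^ n, pow_ne_zero n hq0, ?_, fun s hs => ?_⟩
  · exact (key (RatFunc K) (IsScalarTower.toAlgHom K (Polynomial K) (RatFunc K))
      (fun i => RatFunc.algebraMap_ne_zero (hp i)) (ratPoint p hp)
      fun i => by simp [ratPoint]).2
  · have := key K (Polynomial.aeval s) (fun i => by simpa using hs i) (polyPoint p s hs)
      fun i => by simp [polyPoint]
    simpa using this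

/-- A relation at the generic point means that the common numerator is zero, so it specializes. -/
theorem torusMap_polyPoint_eq_zero {p : Fin (m + 1) → Polynomial K} {hp : ∀ i, p i ≠ 0}
    {f : Laurent K (Fin m)} (hf : torusMap (ratPoint p hp) f = 0) (s : K)
    (hs : ∀ i, (p i).eval s ≠ 0) : torusMap (polyPoint p s hs) f = 0 := by
  obtain ⟨a, b, -, h1, h2⟩ := exists_polynomial_torusMap p hp f
  rw [hf, mul_zero] at h1
  have ha : a = 0 := RatFunc.algebraMap_injective K (by rw [← h1, map_zero])
  have := (h2 s hs).2
  rw [ha, Polynomial.eval_zero] at this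
  exact (mul_eq_zero.1 this).resolve_left (h2 s hs).1

theorem finite_zeros (p : Fin (m + 1) → Polynomial K) (hp : ∀ i, p i ≠ 0) :
    {s : K | ∃ i, (p i).eval s = 0}.Finite := by
  classical
  have : {s : K | ∃ i, (p i).eval s = 0} = ⋃ i, {s : K | (p i).IsRoot s} := by
    ext s; simp [Polynomial.IsRoot]
  rw [this]
  exact Set.finite_iUnion fun i => Polynomial.finite_setOfPred_isRoot (hp i)

/-- The numerator has infinitely many roots. The exceptional set `Z` makes room for discarding a
parameter value, as is needed for `t ↦ t⁻¹`. -/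
theorem torusMap_ratPoint_eq_zero [Infinite K] {p : Fin (m + 1) → Polynomial K}
    {hp : ∀ i, p i ≠ 0} {f : Laurent K (Fin m)} {Z : Set K} (hZ : Z.Finite)
    (hf : ∀ s hs, s ∉ Z → torusMap (polyPoint p s hs) f = 0) :
    torusMap (ratPoint p hp) f = 0 := by
  obtain ⟨a, b, hb, h1, h2⟩ := exists_polynomial_torusMap p hp f
  have ha : a = 0 := by
    refine Polynomial.eq_zero_of_infinite_isRoot a (Set.Infinite.mono ?_
      (hZ.union (finite_zeros p hp)).infinite_compl)
    intro s hs
    simp only [Set.mem_compl_iff, Set.mem_union, not_or, Set.mem_ofPred_eq, not_exists] at hs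
    have := (h2 s hs.2).2
    rw [hf s hs.2 hs.1, mul_zero] at this
    exact this.symm
  rw [ha, map_zero] at h1
  exact (mul_eq_zero.1 h1).resolve_left (RatFunc.algebraMap_ne_zero hb)

end TorusPoints

/-! ### The ideal of the line in its torus -/

section LineIdeal

variable {K : Type*} [Field K] {m : ℕ}

theorem mem_torusIdeal {ι : Type*} [Fintype ι] {Y : Set (ι → Kˣ)} {f : Laurent K ι} :
    f ∈ torusIdeal Y ↔ ∀ x ∈ Y, laurentEval x f = 0 := by
  simp [torusIdeal, RingHom.mem_ker]

/-- The restrictions to `L` of the torus coordinates, as units of the function field. -/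
noncomputable def TorusLine.genericPoint (L : TorusLine K m) : Fin m → (RatFunc K)ˣ :=
  ratPoint L.coord L.coord_ne_zero

theorem TorusLine.prod_genericPoint (L : TorusLine K m) (v : Fin m → ℤ) :
    ((∏ i, L.genericPoint i ^ v i : (RatFunc K)ˣ) : RatFunc K) = L.zpow v := by
  simp [TorusLine.genericPoint, ratPoint, TorusLine.zpow, TorusLine.z]

theorem TorusLine.eval_coord (L : TorusLine K m) (i : Fin (m + 1)) (s : K) :
    (L.coord i).eval s = ((L.b 0 + s • L.b 1 : L.W) : Fin (m + 1) → K) i := by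
  simp [TorusLine.coord]; ring

theorem TorusLine.polyPoint_mem (L : TorusLine K m) (s : K)
    (hs : ∀ i, (L.coord i).eval s ≠ 0) : polyPoint L.coord s hs ∈ L.interior := by
  have h : (Fin.cons 1 (fun i => (polyPoint L.coord s hs i : K)) : Fin (m + 1) → K) =
      ((L.coord 0).eval s)⁻¹ • ((L.b 0 + s • L.b 1 : L.W) : Fin (m + 1) → K) := by
    ext i
    rw [Pi.smul_apply, ← L.eval_coord, smul_eq_mul]
    refine Fin.cases ?_ (fun j => ?_) i
    · simp [inv_mul_cancel₀ (hs 0)]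
    · simp [polyPoint, div_eq_inv_mul]
  change _ ∈ L.W
  rw [h]
  exact L.W.smul_mem _ (Subtype.coe_prop _)

/-- The same line, with the parametrization `t ↦ t⁻¹`. -/
noncomputable def TorusLine.swap (L : TorusLine K m) : TorusLine K m where
  W := L.W
  b := L.b.reindex (Equiv.swap 0 1)
  meets_torus := L.meets_torus

theorem TorusLine.swap_b_zero (L : TorusLine K m) : L.swap.b 0 = L.b 1 := by
  change L.b.reindex (Equiv.swap 0 1) 0 = _
  rw [Module.Basis.reindex_apply, Equiv.symm_swap, Equiv.swap_apply_left]

theorem TorusLine.swap_b_one (L : TorusLine K m) : L.swap.b 1 = L.b 0 := by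
  change L.b.reindex (Equiv.swap 0 1) 1 = _
  rw [Module.Basis.reindex_apply, Equiv.symm_swap, Equiv.swap_apply_right]

theorem TorusLine.eval_swap_coord (L : TorusLine K m) (i : Fin (m + 1)) {s : K} (hs : s ≠ 0) :
    (L.swap.coord i).eval s = s * (L.coord i).eval s⁻¹ := by
  have h0 : ((L.swap.b 0 : L.W) : Fin (m + 1) → K) = L.b 1 := congrArg _ L.swap_b_zero
  have h1 : ((L.swap.b 1 : L.W) : Fin (m + 1) → K) = L.b 0 := congrArg _ L.swap_b_one
  simp only [TorusLine.coord, Polynomial.eval_add, Polynomial.eval_mul, Polynomial.eval_C,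
    Polynomial.eval_X]
  erw [h0, h1]
  field_simp
  ring

/-- The parameter `s` of the swapped line and `s⁻¹` of the original one give the same point, so
vanishing transfers through all `s ≠ 0`. -/
theorem TorusLine.swap_genericPoint_eq_zero [Infinite K] (L : TorusLine K m)
    {f : Laurent K (Fin m)} (hf : torusMap L.genericPoint f = 0) :
    torusMap L.swap.genericPoint f = 0 := by
  refine torusMap_ratPoint_eq_zero (Set.finite_singleton 0) fun s hs hs0 => ?_
  have hs0 : s ≠ 0 := by simpa using hs0
  have h : ∀ i, (L.coord i).eval s⁻¹ ≠ 0 := fun i h0 => hs i (by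
    rw [L.eval_swap_coord i hs0, h0, mul_zero])
  have : polyPoint L.swap.coord s hs = polyPoint L.coord s⁻¹ h := by
    ext i
    simp only [polyPoint, Units.val_div_eq_div_val, Units.val_mk0, L.eval_swap_coord _ hs0]
    rw [mul_div_mul_left _ _ hs0]
  rw [this]
  exact torusMap_polyPoint_eq_zero hf _ _

/-- A point whose `b_0`-coordinate `a` is nonzero is attained by the parametrization, at the value
`c / a` with `c` its `b_1`-coordinate. -/
theorem TorusLine.laurentEval_eq_zero_of_repr (L : TorusLine K m) {f : Laurent K (Fin m)}
    (hf : torusMap L.genericPoint f = 0) {z : Fin m → Kˣ} (hz : z ∈ L.interior)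
    (h0 : L.b.repr ⟨_, hz⟩ 0 ≠ 0) : laurentEval z f = 0 := by
  set a := L.b.repr ⟨_, hz⟩ 0 with ha
  set c := L.b.repr ⟨_, hz⟩ 1 with hc
  have hsum : ((L.b 0 + (c / a) • L.b 1 : L.W) : Fin (m + 1) → K) =
      a⁻¹ • (Fin.cons 1 (fun i => (z i : K)) : Fin (m + 1) → K) := by
    have h := L.b.sum_repr ⟨_, hz⟩
    rw [Fin.sum_univ_two, ← ha, ← hc] at h
    have h' := congrArg (fun w : L.W => a⁻¹ • (w : Fin (m + 1) → K)) h
    simp only at h'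
    rw [← h']
    simp only [Submodule.coe_add, Submodule.coe_smul, smul_add, smul_smul, inv_mul_cancel₀ h0,
      one_smul, div_eq_inv_mul]
  have hev : ∀ i, (L.coord i).eval (c / a) =
      a⁻¹ * (Fin.cons 1 (fun i => (z i : K)) : Fin (m + 1) → K) i := fun i => by
    rw [L.eval_coord, hsum]; rfl
  have hne : ∀ i, (L.coord i).eval (c / a) ≠ 0 := fun i => by
    rw [hev]
    refine mul_ne_zero (inv_ne_zero h0) ?_
    refine Fin.cases ?_ (fun j => ?_) i
    · simp
    · simp
  have hpt : polyPoint L.coord (c / a) hne = z := by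
    ext i
    simp only [polyPoint, Units.val_div_eq_div_val, Units.val_mk0, hev, Fin.cons_succ,
      Fin.cons_zero, mul_one]
    rw [mul_div_cancel_left₀ _ (inv_ne_zero h0)]
  rw [← hpt]
  exact torusMap_polyPoint_eq_zero hf _ hne

/-- A Laurent polynomial vanishes on `L°` iff it vanishes in the function field of `L`. -/
theorem TorusLine.mem_torusIdeal_interior [Infinite K] (L : TorusLine K m)
    {f : Laurent K (Fin m)} : f ∈ torusIdeal L.interior ↔ torusMap L.genericPoint f = 0 := by
  rw [mem_torusIdeal]
  refine ⟨fun h => ?_, fun h z hz => ?_⟩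
  · exact torusMap_ratPoint_eq_zero Set.finite_empty fun s hs _ => h _ (L.polyPoint_mem s hs)
  -- The only point missed by `t ↦ [b_0 + t b_1]` is `[b_1]`; the swapped parametrization reaches it
  -- at `0`.
  · by_cases h0 : L.b.repr ⟨_, hz⟩ 0 = 0
    · refine L.swap.laurentEval_eq_zero_of_repr (L.swap_genericPoint_eq_zero h) (z := z) hz ?_
      intro h1
      have h1' : L.b.repr ⟨_, hz⟩ 1 = 0 := by
        change (L.b.reindex (Equiv.swap 0 1)).repr ⟨_, hz⟩ 0 = 0 at h1
        rw [Module.Basis.repr_reindex_apply, Equiv.symm_swap, Equiv.swap_apply_left] at h1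
        exact h1
      have hs := L.b.sum_repr ⟨_, hz⟩
      rw [Fin.sum_univ_two, h0, h1', zero_smul, zero_smul, add_zero] at hs
      have := congrArg (fun w : L.W => (w : Fin (m + 1) → K) 0) hs
      simp at this
    · exact L.laurentEval_eq_zero_of_repr h hz h0

end LineIdeal

/-! ### The embedded ideal and its slices by degree in `M` -/

section EmbeddedIdeal

variable {K : Type*} [Field K] {M : Type*} [AddCommGroup M] {m : ℕ}

/-- The homomorphism `ℤ^H → M × ℤ^m` sending the basis vector of `u ∈ H` to `u`. -/
def exponentHom (H : Finset (M × (Fin m → ℤ))) : (H → ℤ) →+ M × (Fin m → ℤ) where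
  toFun α := ∑ h, α h • h.1
  map_zero' := by simp
  map_add' α β := by simp [add_smul, Finset.sum_add_distrib]

theorem exponentHom_apply (H : Finset (M × (Fin m → ℤ))) (α : H → ℤ) :
    exponentHom H α = ∑ h, α h • h.1 := rfl

theorem exponentHom_single (H : Finset (M × (Fin m → ℤ))) [DecidableEq H] (h : H) :
    exponentHom H (Pi.single h 1) = h.1 := by
  rw [exponentHom_apply, Finset.sum_eq_single h]
  · simp
  · intro b _ hb; simp [hb]
  · simp

/-- The image is a group containing `H`, hence the semigroup, which generates the whole lattice. -/
theorem exponentHom_surjective [Module.Free ℤ M] [Module.Finite ℤ M] (D : PolyhedralData M m)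
    (H : Finset (M × (Fin m → ℤ)))
    (hH : AddSubmonoid.closure (H : Set (M × (Fin m → ℤ))) = dualSemigroup D) :
    Function.Surjective (exponentHom H) := by
  classical
  rw [← AddMonoidHom.range_eq_top, eq_top_iff, ← closure_dualSemigroup D,
    AddSubgroup.closure_le, ← hH]
  have : AddSubmonoid.closure (H : Set (M × (Fin m → ℤ))) ≤
      (exponentHom H).range.toAddSubmonoid := by
    rw [AddSubmonoid.closure_le]
    exact fun h hh => ⟨Pi.single ⟨h, hh⟩ 1, exponentHom_single H ⟨h, hh⟩⟩
  exact this

/-- The part of degree `u ∈ M` of a Laurent polynomial in the `x_h`, `h ∈ H`, as a Laurent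
polynomial in the coordinates of the line. -/
noncomputable def slice (H : Finset (M × (Fin m → ℤ))) (u : M) :
    Laurent K H →ₗ[K] Laurent K (Fin m) where
  toFun f := AddMonoidAlgebra.mapDomain (fun α => (exponentHom H α).2)
    (component (fun α => (exponentHom H α).1) u f)
  map_add' f g := by rw [map_add, AddMonoidAlgebra.mapDomain_add]
  map_smul' c f := by
    rw [map_smul]
    ext
    simp [AddMonoidAlgebra.mapDomain, Finsupp.mapDomain_smul]

open Classical in
theorem slice_single (H : Finset (M × (Fin m → ℤ))) (u : M) (α : H → ℤ) (c : K) :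
    slice H u (AddMonoidAlgebra.single α c) =
      if (exponentHom H α).1 = u then AddMonoidAlgebra.single (exponentHom H α).2 c else 0 := by
  change AddMonoidAlgebra.mapDomain _ (component _ u _) = _
  rw [component_single]
  split_ifs
  · rw [AddMonoidAlgebra.mapDomain_single]
  · rw [AddMonoidAlgebra.mapDomain_zero]

/-- The map from the Laurent polynomial ring to `K(L)[M]` extending the map to `A(L)`. -/
noncomputable def laurentToFunctionField (L : TorusLine K m) (H : Finset (M × (Fin m → ℤ))) :
    Laurent K H →ₐ[K] AddMonoidAlgebra (RatFunc K) M :=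
  AddMonoidAlgebra.lift K _ (H → ℤ)
    { toFun := fun α => AddMonoidAlgebra.single (exponentHom H (Multiplicative.toAdd α)).1
        (L.zpow (exponentHom H (Multiplicative.toAdd α)).2)
      map_one' := by simp [TorusLine.zpow, AddMonoidAlgebra.one_def]
      map_mul' := fun α β => by
        simp [TorusLine.zpow, AddMonoidAlgebra.single_mul_single, zpow_add₀ (L.z_ne_zero _),
          Finset.prod_mul_distrib] }

theorem laurentToFunctionField_single (L : TorusLine K m) (H : Finset (M × (Fin m → ℤ)))
    (α : H → ℤ) (c : K) : laurentToFunctionField L H (AddMonoidAlgebra.single α c) =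
      c • AddMonoidAlgebra.single (exponentHom H α).1 (L.zpow (exponentHom H α).2) := by
  rw [laurentToFunctionField, AddMonoidAlgebra.lift_single]
  rfl

theorem coeff_laurentToFunctionField (L : TorusLine K m) (H : Finset (M × (Fin m → ℤ)))
    (f : Laurent K H) (u : M) :
    (laurentToFunctionField L H f).coeff u = torusMap L.genericPoint (slice H u f) := by
  classical
  induction f using AddMonoidAlgebra.induction_linear with
  | zero => simp
  | add f g hf hg =>
    rw [map_add, AddMonoidAlgebra.coeff_add, Finsupp.add_apply, hf, hg, map_add, map_add]
  | single α c =>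
    rw [laurentToFunctionField_single, slice_single, AddMonoidAlgebra.coeff_smul_apply,
      AddMonoidAlgebra.coeff_single, Finsupp.single_apply]
    split_ifs
    · rw [torusMap_single, L.prod_genericPoint]
    · simp

/-- This reduces membership in the kernel to one condition on the line for each degree `u`, because
different `χ^u` are independent over `K(L)`. -/
theorem laurentToFunctionField_eq_zero_iff (L : TorusLine K m) (H : Finset (M × (Fin m → ℤ)))
    (f : Laurent K H) : laurentToFunctionField L H f = 0 ↔
      ∀ u, torusMap L.genericPoint (slice H u f) = 0 := by
  simp only [← coeff_laurentToFunctionField]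
  exact ⟨fun h u => by rw [h]; rfl, fun h => by ext u; simpa using h u⟩

/-- The inclusion of the polynomial ring in the Laurent polynomial ring. -/
noncomputable def polyToLaurent (ι : Type*) : MvPolynomial ι K →ₐ[K] Laurent K ι :=
  open Classical in MvPolynomial.aeval fun i => AddMonoidAlgebra.single (Pi.single i 1) 1

theorem polyToLaurent_monomial {ι : Type*} [Fintype ι] (n : ι →₀ ℕ) (c : K) :
    polyToLaurent ι (MvPolynomial.monomial n c) =
      AddMonoidAlgebra.single (fun i => (n i : ℤ)) c := by
  classical
  rw [polyToLaurent, MvPolynomial.aeval_monomial, Finsupp.prod_fintype _ _ (by simp)]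
  simp only [AddMonoidAlgebra.single_pow, one_pow]
  have : ∀ s : Finset ι, ∏ i ∈ s, AddMonoidAlgebra.single (n i • Pi.single i (1 : ℤ)) (1 : K) =
      AddMonoidAlgebra.single (∑ i ∈ s, n i • Pi.single i (1 : ℤ)) (1 : K) := by
    intro s
    induction s using Finset.induction_on with
    | empty => simp [AddMonoidAlgebra.one_def]
    | insert i s hi ih =>
      rw [Finset.prod_insert hi, Finset.sum_insert hi, ih, AddMonoidAlgebra.single_mul_single,
        one_mul]
  rw [this, ← Algebra.smul_def, AddMonoidAlgebra.smul_single, smul_eq_mul, mul_one]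
  congr 1
  ext j
  simp [Finset.sum_apply, Pi.single_apply]

/-- `A(L)` is a subring of `K(L)[M]`, so the kernel can be computed there, where the map extends to
Laurent polynomials. -/
theorem mem_idealJ_iff (D : PolyhedralData M m) (L : TorusLine K m)
    (H : Finset (M × (Fin m → ℤ)))
    (hH : AddSubmonoid.closure (H : Set (M × (Fin m → ℤ))) = dualSemigroup D)
    (F : MvPolynomial H K) : F ∈ idealJ D L H hH ↔
      laurentToFunctionField L H (polyToLaurent H F) = 0 := by
  classical
  have h : (ringA D L).val.comp ((restrictionMap D L).comp (generatorMap K D H hH)) =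
      (laurentToFunctionField L H).comp (polyToLaurent H) := by
    refine MvPolynomial.algHom_ext fun h => ?_
    simp only [AlgHom.comp_apply, generatorMap, polyToLaurent, MvPolynomial.aeval_X]
    rw [laurentToFunctionField_single, exponentHom_single, one_smul, restrictionMap,
      AddMonoidAlgebra.lift_single, one_smul]
    rfl
  have h' := congrArg (fun φ => φ F) h
  simp only [AlgHom.comp_apply] at h'
  rw [← h', idealJ, RingHom.mem_ker]
  exact (map_eq_zero_iff _ Subtype.val_injective).symm

theorem eval_eq_laurentEval {ι : Type*} [Fintype ι] (x : ι → Kˣ) (F : MvPolynomial ι K) :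
    MvPolynomial.eval (fun i => (x i : K)) F = laurentEval x (polyToLaurent ι F) := by
  classical
  have h : MvPolynomial.aeval (fun i => (x i : K)) = (laurentEval x).comp (polyToLaurent ι) := by
    refine MvPolynomial.algHom_ext fun i => ?_
    rw [AlgHom.comp_apply, polyToLaurent, MvPolynomial.aeval_X, MvPolynomial.aeval_X,
      laurentEval_eq_torusMap, torusMap_single, one_smul, Finset.prod_eq_single i]
    · simp
    · intro j _ hj; simp [hj]
    · simp
  rw [← AlgHom.comp_apply, ← h]
  rfl

/-- Every Laurent polynomial becomes a polynomial when multiplied by a monomial. -/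
theorem exists_polyToLaurent_eq_mul {ι : Type*} [Fintype ι] (f : Laurent K ι) :
    ∃ (F : MvPolynomial ι K) (n : ι →₀ ℕ),
      polyToLaurent ι F = polyToLaurent ι (MvPolynomial.monomial n 1) * f := by
  induction f using AddMonoidAlgebra.induction_linear with
  | zero => exact ⟨0, 0, by simp⟩
  | add f g hf hg =>
    obtain ⟨F, n, hF⟩ := hf
    obtain ⟨G, k, hG⟩ := hg
    refine ⟨MvPolynomial.monomial k 1 * F + MvPolynomial.monomial n 1 * G, n + k, ?_⟩
    have : MvPolynomial.monomial (n + k) (1 : K) =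
        MvPolynomial.monomial n 1 * MvPolynomial.monomial k 1 := by
      rw [MvPolynomial.monomial_mul, one_mul]
    rw [this, map_add, map_mul, map_mul, map_mul, hF, hG]
    ring
  | single α c =>
    refine ⟨MvPolynomial.monomial (Finsupp.equivFunOnFinite.symm fun i => (α i).toNat) c,
      Finsupp.equivFunOnFinite.symm fun i => (-α i).toNat, ?_⟩
    rw [polyToLaurent_monomial, polyToLaurent_monomial, AddMonoidAlgebra.single_mul_single, one_mul]
    congr 1
    ext i
    simp only [Finsupp.equivFunOnFinite_symm_apply_apply, Pi.add_apply]
    omega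

theorem zpow_sum {G ι : Type*} [CommGroup G] (g : G) (s : Finset ι) (n : ι → ℤ) :
    g ^ ∑ i ∈ s, n i = ∏ i ∈ s, g ^ n i := by
  classical
  induction s using Finset.induction_on with
  | empty => simp
  | insert i s hi ih => rw [Finset.sum_insert hi, Finset.prod_insert hi, zpow_add, ih]

/-- The point of the torus `(K^*)^H` defined by a point of the torus of `N` and a point of
`(K^*)^m`. -/
def orbitPoint (H : Finset (M × (Fin m → ℤ))) (s : M →+ Additive Kˣ) (z : Fin m → Kˣ) : H → Kˣ :=
  fun h => (s h.1.1).toMul * ∏ i, z i ^ h.1.2 i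

theorem prod_orbitPoint (H : Finset (M × (Fin m → ℤ))) (s : M →+ Additive Kˣ) (z : Fin m → Kˣ)
    (α : H → ℤ) : ∏ h, orbitPoint H s z h ^ α h =
      (s (exponentHom H α).1).toMul * ∏ i, z i ^ (exponentHom H α).2 i := by
  simp only [orbitPoint, mul_zpow, Finset.prod_mul_distrib, exponentHom_apply, Prod.fst_sum,
    Prod.snd_sum, Prod.smul_fst, Prod.smul_snd, map_sum, map_zsmul, toMul_sum, toMul_zsmul,
    Finset.sum_apply, Pi.smul_apply, smul_eq_mul]
  congr 1
  simp only [← Finset.prod_zpow, ← zpow_mul]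
  rw [Finset.prod_comm]
  refine Finset.prod_congr rfl fun i _ => ?_
  rw [zpow_sum]
  exact Finset.prod_congr rfl fun h _ => by rw [mul_comm]

end EmbeddedIdeal

/-! ### Characters of the torus of `N` and the ideal of `X(L)°` -/

section Characters

variable {K : Type*} [Field K] {M : Type*} [AddCommGroup M] {m : ℕ}

theorem exists_unit_zpow_ne_one [Infinite K] {c : ℤ} (hc : c ≠ 0) : ∃ a : Kˣ, a ^ c ≠ 1 := by
  have hn : 0 < c.natAbs := Int.natAbs_pos.2 hc
  -- The factor `X` ensures that a non-root is a unit.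
  have hp : (Polynomial.X * (Polynomial.X ^ c.natAbs - Polynomial.C (1 : K))) ≠ 0 :=
    mul_ne_zero Polynomial.X_ne_zero (Polynomial.X_pow_sub_C_ne_zero hn 1)
  obtain ⟨a, ha⟩ : ∃ a, (Polynomial.X * (Polynomial.X ^ c.natAbs - Polynomial.C (1 : K))).eval a
      ≠ 0 := by
    by_contra! h
    exact hp (Polynomial.funext fun a => by rw [h a, Polynomial.eval_zero])
  simp only [Polynomial.eval_mul, Polynomial.eval_X, Polynomial.eval_sub, Polynomial.eval_pow,
    Polynomial.eval_C, ne_eq, mul_eq_zero, not_or, sub_eq_zero] at ha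
  obtain ⟨ha0, ha1⟩ := ha
  refine ⟨Units.mk0 a ha0, fun h => ha1 ?_⟩
  have h' : (Units.mk0 a ha0) ^ c.natAbs = 1 := by
    rcases Int.natAbs_eq c with h1 | h1
    · rw [h1, zpow_natCast] at h; exact h
    · rw [h1, zpow_neg, inv_eq_one, zpow_natCast] at h; exact h
  simpa using congrArg Units.val h'

theorem exists_character_ne [Infinite K] [Module.Free ℤ M] {u u' : M} (h : u ≠ u') :
    ∃ s : M →+ Additive Kˣ, s u ≠ s u' := by
  let b := Module.Free.chooseBasis ℤ M
  obtain ⟨j, hj⟩ : ∃ j, b.repr (u - u') j ≠ 0 := by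
    by_contra! hall
    exact h (sub_eq_zero.1 (b.repr.map_eq_zero_iff.1 (Finsupp.ext hall)))
  obtain ⟨a, ha⟩ := exists_unit_zpow_ne_one (K := K) hj
  refine ⟨(zmultiplesHom (Additive Kˣ) (Additive.ofMul a)).comp (b.coord j).toAddMonoidHom,
    fun hs => ha ?_⟩
  rw [← sub_eq_zero, ← map_sub] at hs
  exact congrArg Additive.toMul hs

/-- Evaluation at `u`, as a character of the torus with character lattice `M`. -/
def evalCharacter (K : Type*) [Field K] (u : M) : Multiplicative (M →+ Additive Kˣ) →* K where
  toFun s := (((Multiplicative.toAdd s) u).toMul : K)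
  map_one' := by simp
  map_mul' s t := by simp

/-- Dedekind's independence of characters; distinct `u` give distinct characters since the torus
separates the points of `M`. -/
theorem linearIndependent_evalCharacter [Infinite K] [Module.Free ℤ M] :
    LinearIndependent K fun u : M =>
      (evalCharacter K u : Multiplicative (M →+ Additive Kˣ) → K) := by
  refine (linearIndependent_monoidHom (Multiplicative (M →+ Additive Kˣ)) K).comp
    (evalCharacter K) fun u u' h => ?_
  by_contra hne
  obtain ⟨s, hs⟩ := exists_character_ne (K := K) hne
  refine hs (Additive.toMul.injective (Units.ext ?_))
  exact DFunLike.congr_fun h (Multiplicative.ofAdd s)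

theorem laurentEval_orbitPoint_component (H : Finset (M × (Fin m → ℤ))) (s : M →+ Additive Kˣ)
    (z : Fin m → Kˣ) (u : M) (f : Laurent K H) :
    laurentEval (orbitPoint H s z) (component (fun α => (exponentHom H α).1) u f) =
      (((s u).toMul : Kˣ) : K) * laurentEval z (slice H u f) := by
  classical
  induction f using AddMonoidAlgebra.induction_linear with
  | zero => simp
  | add f g hf hg => rw [map_add, map_add, hf, hg, map_add, map_add, mul_add]
  | single α c =>
    rw [component_single, slice_single]
    by_cases h : (exponentHom H α).1 = u
    · rw [if_pos h, if_pos h, laurentEval_eq_torusMap, torusMap_single, prod_orbitPoint, h,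
        laurentEval_eq_torusMap, torusMap_single, Units.val_mul, smul_eq_mul, smul_eq_mul]
      ring
    · rw [if_neg h, if_neg h, map_zero, map_zero, mul_zero]

open Classical in
theorem laurentEval_orbitPoint (H : Finset (M × (Fin m → ℤ))) (s : M →+ Additive Kˣ)
    (z : Fin m → Kˣ) (f : Laurent K H) :
    laurentEval (orbitPoint H s z) f =
      ∑ u ∈ f.coeff.support.image fun α => (exponentHom H α).1,
        (((s u).toMul : Kˣ) : K) * laurentEval z (slice H u f) := by
  conv_lhs => rw [← sum_component (fun α => (exponentHom H α).1) f]
  rw [map_sum]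
  exact Finset.sum_congr rfl fun u _ => laurentEval_orbitPoint_component H s z u f

theorem slice_eq_zero (H : Finset (M × (Fin m → ℤ))) (u : M) (f : Laurent K H)
    (h : ∀ α, f.coeff α ≠ 0 → (exponentHom H α).1 ≠ u) : slice H u f = 0 := by
  classical
  have : component (fun α => (exponentHom H α).1) u f = 0 := by
    ext α
    rw [component_apply]
    split_ifs with hα
    · by_contra hne
      exact h α hne hα
    · rfl
  change AddMonoidAlgebra.mapDomain _ (component _ u _) = _
  rw [this, AddMonoidAlgebra.mapDomain_zero]

/-- The ideal of `X(L)°` is the kernel of the map to `K(L)[M]`. -/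
theorem mem_torusIdeal_interiorX [Infinite K] [Module.Free ℤ M] (D : PolyhedralData M m)
    (L : TorusLine K m) (H : Finset (M × (Fin m → ℤ)))
    (hH : AddSubmonoid.closure (H : Set (M × (Fin m → ℤ))) = dualSemigroup D) {f : Laurent K H} :
    f ∈ torusIdeal (interiorX D L H hH) ↔ laurentToFunctionField L H f = 0 := by
  classical
  rw [mem_torusIdeal]
  constructor
  · intro h
    rw [laurentToFunctionField_eq_zero_iff]
    intro u
    rw [← L.mem_torusIdeal_interior, mem_torusIdeal]
    intro z hz
    -- The torus of `N` acts on `X(L)°`: on the degree-`u` part of an element of `J(L)` it only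
    -- contributes the scalar `s(u)`, and the slice vanishes at `z`.
    have hX : ∀ s : M →+ Additive Kˣ, orbitPoint H s z ∈ interiorX D L H hH := by
      intro s F hF
      rw [mem_idealJ_iff, laurentToFunctionField_eq_zero_iff] at hF
      rw [eval_eq_laurentEval, laurentEval_orbitPoint]
      refine Finset.sum_eq_zero fun u _ => ?_
      rw [mem_torusIdeal.1 (L.mem_torusIdeal_interior.2 (hF u)) z hz, mul_zero]
    by_cases hu : u ∈ f.coeff.support.image fun α => (exponentHom H α).1
    -- Vanishing of `f` along the whole orbit is a linear relation among characters whose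
    -- coefficients are the values of the slices at `z`.
    · refine linearIndependent_iff'.1 (linearIndependent_evalCharacter (K := K) (M := M))
        (f.coeff.support.image fun α => (exponentHom H α).1)
        (fun u => laurentEval z (slice H u f)) ?_ u hu
      ext s
      have := h _ (hX (Multiplicative.toAdd s))
      rw [laurentEval_orbitPoint] at this
      rw [Finset.sum_apply, Pi.zero_apply, ← this]
      refine Finset.sum_congr rfl fun v _ => ?_
      rw [Pi.smul_apply, smul_eq_mul, mul_comm]
      rfl
    · rw [slice_eq_zero, map_zero]
      intro α hα hαu
      exact hu (Finset.mem_image.2 ⟨α, Finsupp.mem_support_iff.2 hα, hαu⟩)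
  · intro h x hx
    -- Clearing denominators produces an element of `J(L)`, and the monomial used does not vanish on
    -- the torus.
    obtain ⟨F, n, hF⟩ := exists_polyToLaurent_eq_mul f
    have hFJ : F ∈ idealJ D L H hH := by rw [mem_idealJ_iff, hF, map_mul, h, mul_zero]
    have h1 := hx F hFJ
    rw [eval_eq_laurentEval, hF, map_mul] at h1
    refine (mul_eq_zero.1 h1).resolve_left ?_
    rw [polyToLaurent_monomial, laurentEval_eq_torusMap, torusMap_single, one_smul]
    exact Units.ne_zero _

end Characters

/-! ### The tropicalization of `X(L)°` as a product -/

section Tropicalization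

variable {K : Type*} [Field K] {M : Type*} [AddCommGroup M] {m : ℕ}

/-- The weight of Laurent exponents, as a homomorphism. -/
def laurentWeightHom {ι : Type*} [Fintype ι] (w : ι → ℝ) : (ι → ℤ) →+ ℝ where
  toFun := laurentWeight w
  map_zero' := by simp [laurentWeight]
  map_add' α β := by simp [laurentWeight, mul_add, Finset.sum_add_distrib]

@[simp] theorem laurentWeightHom_apply {ι : Type*} [Fintype ι] (w : ι → ℝ) (α : ι → ℤ) :
    laurentWeightHom w α = laurentWeight w α := rfl

/-- The working criterion: it replaces the ideal generated by initial forms by single elements of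
the ideal of `Y`. -/
theorem mem_trop_iff {ι : Type*} [Fintype ι] {Y : Set (ι → Kˣ)} {w : ι → ℝ} :
    w ∈ trop Y ↔ ∀ (α : ι → ℤ) (f : Laurent K ι),
      (∀ β, f.coeff β ≠ 0 → laurentWeight w α < laurentWeight w β) →
      AddMonoidAlgebra.single α 1 + f ∉ torusIdeal Y := by
  refine forall_congr' fun α => ?_
  have := single_mem_initialIdeal_iff (laurentWeightHom w) (I := torusIdeal Y) α
  change AddMonoidAlgebra.single α (1 : K) ∈ initialIdeal (laurentWeight w) (torusIdeal Y) ↔ _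
    at this
  rw [this]
  push Not
  rfl

theorem laurentWeight_tropMap (H : Finset (M × (Fin m → ℤ))) (v : (M →+ ℝ) × (Fin m → ℝ))
    (α : H → ℤ) : laurentWeight (tropMap H v) α = pairing v (exponentHom H α) := by
  rw [← pairingHom_apply, exponentHom_apply, map_sum]
  refine Finset.sum_congr rfl fun h _ => ?_
  rw [map_zsmul, zsmul_eq_mul, mul_comm]
  rfl

theorem pairing_eq (v : (M →+ ℝ) × (Fin m → ℝ)) (u : M × (Fin m → ℤ)) :
    pairing v u = v.1 u.1 + laurentWeight v.2 u.2 := rfl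

/-- A weight that vanishes on the relations among the elements of `H` lies in the image of `φ`. -/
theorem exists_tropMap_eq {H : Finset (M × (Fin m → ℤ))}
    (hA : Function.Surjective (exponentHom H)) {w : H → ℝ}
    (hw : ∀ α, exponentHom H α = 0 → laurentWeight w α = 0) : ∃ v, tropMap H v = w := by
  classical
  -- The weight descends to the quotient `M × ℤ^m` of `ℤ^H`; restricting it to the two factors gives
  -- the components of `v`.
  let ℓ : M × (Fin m → ℤ) →+ ℝ := (exponentHom H).liftOfSurjective hA
    ⟨laurentWeightHom w, fun α hα => hw α hα⟩
  have hℓ : ∀ α, ℓ (exponentHom H α) = laurentWeight w α := fun α =>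
    AddMonoidHom.liftOfRightInverse_comp_apply _ _ _ ⟨laurentWeightHom w, fun α hα => hw α hα⟩ α
  refine ⟨(ℓ.comp (AddMonoidHom.inl _ _), fun i => ℓ (0, Pi.single i 1)), ?_⟩
  ext h
  have h1 : laurentWeight w (Pi.single h 1) = w h := by
    rw [laurentWeight, Finset.sum_eq_single h]
    · simp
    · intro b _ hb; simp [hb]
    · simp
  rw [← h1, ← hℓ, exponentHom_single]
  change ℓ (h.1.1, 0) + ∑ i, ℓ (0, Pi.single i 1) * (h.1.2 i : ℝ) = ℓ h.1
  have h2 : h.1 = (h.1.1, 0) + ∑ i, h.1.2 i • ((0 : M), (Pi.single i 1 : Fin m → ℤ)) := by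
    apply Prod.ext
    · simp [Prod.fst_sum]
    · simpa [Prod.snd_sum] using pi_eq_sum_univ' h.1.2
  conv_rhs => rw [h2]
  rw [map_add, map_sum]
  congr 1
  refine Finset.sum_congr rfl fun i _ => ?_
  rw [map_zsmul, zsmul_eq_mul, mul_comm]

/-- A vector that pairs to zero with `H` pairs to zero with all of `M × ℤ^m`, which separates `(N ⊕
ℤ^m)_ℝ`. -/
theorem tropMap_injective {H : Finset (M × (Fin m → ℤ))}
    (hA : Function.Surjective (exponentHom H)) : Function.Injective (tropMap H) := by
  classical
  rw [← LinearMap.ker_eq_bot, LinearMap.ker_eq_bot']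
  intro v hv
  have h : ∀ u, pairing v u = 0 := by
    intro u
    obtain ⟨α, rfl⟩ := hA u
    rw [← laurentWeight_tropMap, hv]
    simp [laurentWeight]
  apply Prod.ext
  · ext u
    simpa [pairing] using h (u, 0)
  · ext i
    simpa [pairing, Pi.single_apply] using h (0, Pi.single i 1)

open Classical in
theorem slice_coeff_ne_zero (H : Finset (M × (Fin m → ℤ))) (u : M) (f : Laurent K H)
    {β : Fin m → ℤ} (hβ : (slice H u f).coeff β ≠ 0) :
    ∃ α, f.coeff α ≠ 0 ∧ exponentHom H α = (u, β) := by
  change (Finsupp.mapDomain _ (component _ u f).coeff) β ≠ 0 at hβ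
  obtain ⟨α, hα, hαβ⟩ := Finset.mem_image.1
    (Finsupp.mapDomain_support (Finsupp.mem_support_iff.2 hβ))
  rw [Finsupp.mem_support_iff, component_apply] at hα
  have hu : (exponentHom H α).1 = u := by by_contra hn; simp [hn] at hα
  rw [if_pos hu] at hα
  exact ⟨α, hα, Prod.ext hu hαβ⟩

/-- The tropicalization of `X(L)°` is the image of `N_ℝ × trop(L°)`. -/
theorem trop_interiorX [Infinite K] [Module.Free ℤ M] [Module.Finite ℤ M]
    (D : PolyhedralData M m)
    (L : TorusLine K m) (H : Finset (M × (Fin m → ℤ)))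
    (hH : AddSubmonoid.closure (H : Set (M × (Fin m → ℤ))) = dualSemigroup D) :
    trop (interiorX D L H hH) = tropMap H '' (Set.univ ×ˢ trop L.interior) := by
  classical
  have hA := exponentHom_surjective D H hH
  have hX : ∀ f, f ∈ torusIdeal (interiorX D L H hH) ↔
      ∀ u, torusMap L.genericPoint (slice H u f) = 0 := fun f => by
    rw [mem_torusIdeal_interiorX, laurentToFunctionField_eq_zero_iff]
  ext w
  constructor
  · intro hw
    rw [mem_trop_iff] at hw
    obtain ⟨v, rfl⟩ := exists_tropMap_eq hA (w := w) fun α hα => by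
      -- The binomial `1 - χ^β` is in the ideal; were the weight of `β` positive, its initial form
      -- would be the monomial `1`. Negative weights are handled through `-α`.
      have hbinom : ∀ β, exponentHom H β = 0 → 0 ≤ laurentWeight w β →
          laurentWeight w β = 0 := by
        intro β hβ h0
        by_contra hne
        refine hw 0 (-AddMonoidAlgebra.single β 1) (fun γ hγ => ?_) ?_
        · have : γ = β := by
            by_contra hn
            simp [AddMonoidAlgebra.coeff_single, hn] at hγ
          rw [this, ← laurentWeightHom_apply, map_zero]
          exact lt_of_le_of_ne h0 (Ne.symm hne)
        · rw [mem_torusIdeal_interiorX, map_add, map_neg, laurentToFunctionField_single,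
            laurentToFunctionField_single, hβ, map_zero, add_neg_cancel]
      rcases le_total 0 (laurentWeight w α) with h0 | h0
      · exact hbinom α hα h0
      · have hneg : laurentWeight w (-α) = -laurentWeight w α :=
          map_neg (laurentWeightHom w) α
        have := hbinom (-α) (by rw [map_neg, hα, neg_zero]) (by rw [hneg]; linarith)
        linarith
    refine ⟨v, ⟨Set.mem_univ _, ?_⟩, rfl⟩
    rw [mem_trop_iff]
    intro γ g hg hmem
    -- An element of the ideal of `L°` is lifted to degree `0 ∈ M`, where the weight `φ(v)` of a
    -- lifted exponent equals its weight under `v.2`.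
    choose B hB using fun β : Fin m → ℤ => hA (0, β)
    have hBinj : Function.Injective B := fun β β' h => by
      have := (hB β).symm.trans ((congrArg _ h).trans (hB β'))
      exact congrArg Prod.snd this
    refine hw (B γ) (AddMonoidAlgebra.mapDomain B g) (fun α hα => ?_) ?_
    · obtain ⟨β, hβ, rfl⟩ := Finset.mem_image.1
        (Finsupp.mapDomain_support (Finsupp.mem_support_iff.2 hα))
      rw [laurentWeight_tropMap, laurentWeight_tropMap, hB, hB, pairing_eq, pairing_eq]
      have := hg β (Finsupp.mem_support_iff.1 hβ)
      simpa using this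
    · have hslice : ∀ (u : M) (h : Laurent K (Fin m)),
          slice H u (AddMonoidAlgebra.mapDomain B h) = if (0 : M) = u then h else 0 := by
        intro u h
        induction h using AddMonoidAlgebra.induction_linear with
        | zero => simp
        | add f g hf hg =>
          rw [AddMonoidAlgebra.mapDomain_add, map_add, hf, hg]
          split_ifs <;> simp
        | single β c => rw [AddMonoidAlgebra.mapDomain_single, slice_single, hB]
      rw [hX]
      intro u
      have h1 : AddMonoidAlgebra.single (B γ) (1 : K) + AddMonoidAlgebra.mapDomain B g =
          AddMonoidAlgebra.mapDomain B (AddMonoidAlgebra.single γ 1 + g) := by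
        rw [AddMonoidAlgebra.mapDomain_add, AddMonoidAlgebra.mapDomain_single]
      rw [h1, hslice]
      split_ifs
      · exact L.mem_torusIdeal_interior.1 hmem
      · rw [map_zero]
  · rintro ⟨⟨n, y⟩, ⟨-, hy⟩, rfl⟩
    rw [mem_trop_iff]
    intro α f hf hmem
    -- Within the degree of `α` the contribution of `n` is constant, so passing to this slice
    -- preserves the strict inequalities between weights.
    refine mem_trop_iff.1 hy (exponentHom H α).2 (slice H (exponentHom H α).1 f)
      (fun β hβ => ?_) ?_
    · obtain ⟨α', hα', hαβ⟩ := slice_coeff_ne_zero H _ f hβ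
      have := hf α' hα'
      rw [laurentWeight_tropMap, laurentWeight_tropMap, hαβ, pairing_eq, pairing_eq] at this
      simpa using this
    · rw [L.mem_torusIdeal_interior]
      have := (hX _).1 hmem (exponentHom H α).1
      rwa [map_add, slice_single, if_pos rfl] at this

/-- `N_ℝ = Hom(M, ℝ)` in terms of a basis of `M`. -/
noncomputable def realDualEquiv (M : Type*) [AddCommGroup M] [Module.Free ℤ M]
    [Module.Finite ℤ M] :
    (M →+ ℝ) ≃ₗ[ℝ] (Module.Free.ChooseBasisIndex ℤ M → ℝ) where
  toFun n j := n (Module.Free.chooseBasis ℤ M j)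
  map_add' _ _ := rfl
  map_smul' _ _ := rfl
  invFun c := ∑ j, c j • (Int.castAddHom ℝ).comp
    ((Module.Free.chooseBasis ℤ M).coord j).toAddMonoidHom
  left_inv n := (eq_sum_smul_coord n).symm
  right_inv c := by
    ext i
    simp [Finsupp.single_apply]

instance [Module.Free ℤ M] [Module.Finite ℤ M] : Module.Finite ℝ (M →+ ℝ) :=
  Module.Finite.equiv (realDualEquiv M).symm

theorem finrank_realDual [Module.Free ℤ M] [Module.Finite ℤ M] :
    Module.finrank ℝ (M →+ ℝ) = Module.finrank ℤ (M →+ ℤ) := by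
  rw [(realDualEquiv M).finrank_eq, Module.finrank_fintype_fun_eq_card,
    (addMonoidHomLequivInt (A := M) (B := ℤ) ℤ).finrank_eq]
  change _ = Module.finrank ℤ (Module.Dual ℤ M)
  rw [Module.finrank_linearMap, Module.finrank_self, mul_one,
    Module.finrank_eq_card_chooseBasisIndex]

/-- `P` and `ψ` are the restrictions of `φ` to the two factors: `P = φ(N_ℝ × 0)` and `ψ(y) = φ(0,
y)`. -/
theorem trop_eq_add [Infinite K] [Module.Free ℤ M] [Module.Finite ℤ M] (D : PolyhedralData M m)
    (L : TorusLine K m) (H : Finset (M × (Fin m → ℤ)))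
    (hH : AddSubmonoid.closure (H : Set (M × (Fin m → ℤ))) = dualSemigroup D) :
    ∃ (P : Submodule ℝ (H → ℝ)) (ψ : (Fin m → ℝ) →ₗ[ℝ] (H → ℝ)),
      Module.finrank ℝ P = Module.finrank ℤ (M →+ ℤ) ∧
      Function.Injective ψ ∧ Disjoint P (LinearMap.range ψ) ∧
      trop (interiorX D L H hH) = (P : Set (H → ℝ)) + ψ '' trop L.interior := by
  have hinj := tropMap_injective (exponentHom_surjective D H hH)
  refine ⟨LinearMap.range ((tropMap H).comp (LinearMap.inl ℝ (M →+ ℝ) (Fin m → ℝ))),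
    (tropMap H).comp (LinearMap.inr ℝ (M →+ ℝ) (Fin m → ℝ)), ?_, ?_, ?_, ?_⟩
  · rw [LinearMap.finrank_range_of_inj, finrank_realDual]
    exact hinj.comp LinearMap.inl_injective
  · exact hinj.comp LinearMap.inr_injective
  · rw [Submodule.disjoint_def]
    rintro _ ⟨n, rfl⟩ ⟨y, hy⟩
    have h := hinj hy
    have : n = 0 := (congrArg Prod.fst h).symm
    rw [this, map_zero]
  · rw [trop_interiorX]
    ext w
    constructor
    · rintro ⟨⟨n, y⟩, ⟨-, hy⟩, rfl⟩
      refine ⟨_, ⟨n, rfl⟩, _, ⟨y, hy, rfl⟩, ?_⟩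
      simp [← map_add]
    · rintro ⟨_, ⟨n, rfl⟩, _, ⟨y, hy, rfl⟩, rfl⟩
      refine ⟨(n, y), ⟨Set.mem_univ _, hy⟩, ?_⟩
      simp [← map_add]

end Tropicalization

/-! ### The tropical line with distinct points `Q_i` -/

section TropicalLine

variable {K : Type*} [Field K] {m : ℕ}

theorem mem_ray_iff {i : Fin (m + 1)} {y : Fin m → ℝ} :
    y ∈ ray i ↔ ∃ t : ℝ, 0 ≤ t ∧ y = t • e ℝ i := by
  rw [ray, PointedCone.hull, Submodule.mem_span_singleton]
  constructor
  · rintro ⟨t, rfl⟩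
    exact ⟨t, t.2, rfl⟩
  · rintro ⟨t, ht, rfl⟩
    exact ⟨⟨t, ht⟩, rfl⟩

/-- The function `z_j` has a simple zero at `Q_j`, a simple pole at `Q_0` and no others, with no
cancellation as the points are distinct. So `e_i` lists the orders of the `z_j` at `Q_i`. -/
theorem TorusLine.ordAt_zpow (L : TorusLine K m) (hQ : Function.Injective L.Q)
    (i : Fin (m + 1)) (α : Fin m → ℤ) :
    (ordAt (L.Q i) (L.zpow α) : ℝ) = laurentWeight (e ℝ i) α := by
  classical
  rw [TorusLine.zpow, ordAt_prod _ _ _ fun j => zpow_ne_zero _ (L.z_ne_zero j), laurentWeight]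
  push_cast
  refine Finset.sum_congr rfl fun j _ => ?_
  rw [SemiCanonical.ordAt_zpow _ (L.z_ne_zero j), L.ordAt_z]
  simp only [hQ.eq_iff]
  refine Fin.cases ?_ (fun k => ?_) i
  · simp [e, Fin.succ_ne_zero]
  · simp only [e, Fin.cases_succ, Fin.succ_inj, (Fin.succ_ne_zero k).symm, if_false, sub_zero,
      Pi.single_apply]
    split_ifs <;> simp

theorem TorusLine.zpow_ne_zero (L : TorusLine K m) (α : Fin m → ℤ) : L.zpow α ≠ 0 :=
  Finset.prod_ne_zero_iff.2 fun i _ => _root_.zpow_ne_zero _ (L.z_ne_zero i)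

theorem TorusLine.lt_ordAt_torusMap (L : TorusLine K m) (P : OnePoint K) (N : ℤ)
    (f : Laurent K (Fin m)) (hf : ∀ β, f.coeff β ≠ 0 → N < ordAt P (L.zpow β)) :
    torusMap L.genericPoint f = 0 ∨ N < ordAt P (torusMap L.genericPoint f) := by
  have hsum : f = ∑ β ∈ f.coeff.support, AddMonoidAlgebra.single β (f.coeff β) :=
    f.sum_coeff_single.symm
  rw [hsum, map_sum]
  refine Finset.sum_induction _ (fun g => g = 0 ∨ N < ordAt P g) ?_ (Or.inl rfl) ?_
  · rintro g h (rfl | hg) (rfl | hh)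
    · left; simp
    · right; simpa using hh
    · right; simpa using hg
    · by_cases hg0 : g = 0
      · subst hg0; right; simpa using hh
      by_cases hh0 : h = 0
      · subst hh0; right; simpa using hg
      by_cases h0 : g + h = 0
      · left; exact h0
      · right
        exact lt_of_lt_of_le (lt_min hg hh) (ordAt_add P hg0 hh0 h0)
  · intro β hβ
    have hβ' := Finsupp.mem_support_iff.1 hβ
    right
    rw [torusMap_single, L.prod_genericPoint, Algebra.smul_def,
      ordAt_mul P (by simpa using hβ') (L.zpow_ne_zero β), ordAt_C, zero_add]
    exact hf β hβ'

/-- On `ρ_i` the weight is a multiple of the order at `Q_i`. In a relation `χ^α + f = 0` on `L` with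
`f` of larger weight, `f` would be zero or have strictly larger order than `χ^α`, although it is
`-χ^α`. -/
theorem TorusLine.ray_subset_trop [Infinite K] (L : TorusLine K m)
    (hQ : Function.Injective L.Q) (i : Fin (m + 1)) :
    (ray i : Set (Fin m → ℝ)) ⊆ trop L.interior := by
  intro y hy
  obtain ⟨t, ht, rfl⟩ := mem_ray_iff.1 hy
  rw [mem_trop_iff]
  intro α f hf hmem
  have hw : ∀ β, laurentWeight (t • e ℝ i) β = t * ordAt (L.Q i) (L.zpow β) := by
    intro β
    rw [L.ordAt_zpow hQ, laurentWeight, laurentWeight, Finset.mul_sum]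
    exact Finset.sum_congr rfl fun j _ => by rw [Pi.smul_apply, smul_eq_mul, mul_assoc]
  have hord := L.lt_ordAt_torusMap (L.Q i) (ordAt (L.Q i) (L.zpow α)) f fun β hβ => by
    have := hf β hβ
    rw [hw, hw] at this
    exact_mod_cast lt_of_mul_lt_mul_left this ht
  rw [L.mem_torusIdeal_interior, map_add, torusMap_single, one_smul, L.prod_genericPoint] at hmem
  have hneg := eq_neg_of_add_eq_zero_right hmem
  rcases hord with h0 | hlt
  · rw [h0, zero_eq_neg] at hneg
    exact L.zpow_ne_zero α hneg
  · rw [hneg, ← neg_one_mul, ordAt_mul _ (by simp) (L.zpow_ne_zero α)] at hlt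
    have h1 := ordAt_C (L.Q i) (-1 : K)
    rw [map_neg, map_one] at h1
    rw [h1, zero_add] at hlt
    exact lt_irrefl _ hlt

/-- Two nonzero linear forms on `L` with vanishing determinant are proportional and have the same
zero. -/
theorem TorusLine.det_ne_zero (L : TorusLine K m) {j k : Fin (m + 1)} (h : L.Q j ≠ L.Q k) :
    (L.b 0 : Fin (m + 1) → K) j * (L.b 1 : Fin (m + 1) → K) k -
      (L.b 0 : Fin (m + 1) → K) k * (L.b 1 : Fin (m + 1) → K) j ≠ 0 := by
  have hne : ∀ i, (L.b 1 : Fin (m + 1) → K) i = 0 → (L.b 0 : Fin (m + 1) → K) i ≠ 0 := by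
    intro i h1 h0
    exact L.coord_ne_zero i (by rw [TorusLine.coord, h0, h1]; simp)
  intro hdet
  apply h
  by_cases hj : (L.b 1 : Fin (m + 1) → K) j = 0 <;> by_cases hk : (L.b 1 : Fin (m + 1) → K) k = 0
  · simp [TorusLine.Q, hj, hk]
  · rw [hj, mul_zero, sub_zero] at hdet
    exact absurd hdet (mul_ne_zero (hne j hj) hk)
  · rw [hk, mul_zero, zero_sub, neg_eq_zero] at hdet
    exact absurd hdet (mul_ne_zero (hne k hk) hj)
  · simp only [TorusLine.Q, if_neg hj, if_neg hk]
    rw [OnePoint.coe_eq_coe, div_eq_div_iff hj hk]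
    linear_combination -hdet

/-- The exponents of the Laurent monomials `y_i / y_0`. -/
def coordExponent : Fin (m + 1) → (Fin m → ℤ) := Fin.cons 0 fun i => Pi.single i 1

theorem TorusLine.torusMap_coordExponent (L : TorusLine K m) (i : Fin (m + 1)) (c : K) :
    torusMap L.genericPoint (AddMonoidAlgebra.single (coordExponent i) c) =
      c • (algebraMap _ (RatFunc K) (L.coord i) / algebraMap _ (RatFunc K) (L.coord 0)) := by
  rw [torusMap_single, L.prod_genericPoint]
  congr 1
  refine Fin.cases ?_ (fun k => ?_) i
  · rw [div_self (RatFunc.algebraMap_ne_zero (L.coord_ne_zero 0))]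
    simp [TorusLine.zpow, coordExponent]
  · rw [TorusLine.zpow, Finset.prod_eq_single k]
    · simp [coordExponent, TorusLine.z]
    · intro b _ hb; simp [coordExponent, hb]
    · simp

theorem laurentWeight_coordExponent (y : Fin m → ℝ) (i : Fin (m + 1)) :
    laurentWeight y (coordExponent i) = (Fin.cons 0 y : Fin (m + 1) → ℝ) i := by
  refine Fin.cases ?_ (fun k => ?_) i
  · simp [laurentWeight, coordExponent]
  · rw [laurentWeight, Finset.sum_eq_single k]
    · simp [coordExponent]
    · intro b _ hb; simp [coordExponent, hb]
    · simp

/-- At a point of `trop(L°)` at most one homogeneous coordinate exceeds the minimal one. -/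
theorem TorusLine.eq_of_mem_trop [Infinite K] (L : TorusLine K m)
    (hQ : Function.Injective L.Q) {y : Fin m → ℝ} (hy : y ∈ trop L.interior)
    {i j k : Fin (m + 1)}
    (hj : (Fin.cons 0 y : Fin (m + 1) → ℝ) i < Fin.cons (α := fun _ => ℝ) 0 y j)
    (hk : (Fin.cons 0 y : Fin (m + 1) → ℝ) i < Fin.cons (α := fun _ => ℝ) 0 y k) : j = k := by
  by_contra hne
  have hdet := L.det_ne_zero (hQ.ne hne)
  set d := (L.b 0 : Fin (m + 1) → K) j * (L.b 1 : Fin (m + 1) → K) k -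
      (L.b 0 : Fin (m + 1) → K) k * (L.b 1 : Fin (m + 1) → K) j with hd
  -- Cramer's rule for `y_i = p y_j + q y_k` on `L`. After division by `y_0`, the initial form of
  -- this relation would be a monomial if both `y_j` and `y_k` had larger weight than `y_i`.
  set p := ((L.b 0 : Fin (m + 1) → K) i * (L.b 1 : Fin (m + 1) → K) k -
      (L.b 0 : Fin (m + 1) → K) k * (L.b 1 : Fin (m + 1) → K) i) / d with hp
  set q := ((L.b 0 : Fin (m + 1) → K) j * (L.b 1 : Fin (m + 1) → K) i -
      (L.b 0 : Fin (m + 1) → K) i * (L.b 1 : Fin (m + 1) → K) j) / d with hq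
  have hcoord : L.coord i = Polynomial.C p * L.coord j + Polynomial.C q * L.coord k := by
    have h0 : (L.b 0 : Fin (m + 1) → K) i =
        p * (L.b 0 : Fin (m + 1) → K) j + q * (L.b 0 : Fin (m + 1) → K) k := by
      rw [hp, hq]; field_simp; rw [hd]; ring
    have h1 : (L.b 1 : Fin (m + 1) → K) i =
        p * (L.b 1 : Fin (m + 1) → K) j + q * (L.b 1 : Fin (m + 1) → K) k := by
      rw [hp, hq]; field_simp; rw [hd]; ring
    rw [TorusLine.coord, TorusLine.coord, TorusLine.coord, h0, h1]
    simp only [map_add, map_mul]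
    ring
  refine mem_trop_iff.1 hy (coordExponent i)
    (-(AddMonoidAlgebra.single (coordExponent j) p + AddMonoidAlgebra.single (coordExponent k) q))
    (fun β hβ => ?_) ?_
  · have : β = coordExponent j ∨ β = coordExponent k := by
      by_contra! hn
      exact hβ (by simp [AddMonoidAlgebra.coeff_single, hn.1, hn.2])
    rcases this with rfl | rfl
    · rw [laurentWeight_coordExponent, laurentWeight_coordExponent]; exact hj
    · rw [laurentWeight_coordExponent, laurentWeight_coordExponent]; exact hk
  · rw [L.mem_torusIdeal_interior, map_add, map_neg, map_add, L.torusMap_coordExponent,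
      L.torusMap_coordExponent, L.torusMap_coordExponent, hcoord, one_smul, Algebra.smul_def,
      Algebra.smul_def, map_add, map_mul, map_mul, RatFunc.algebraMap_C, RatFunc.algebraMap_C,
      RatFunc.algebraMap_eq_C]
    ring

/-- The tropicalization of a line meeting the coordinate hyperplanes in distinct points. -/
theorem TorusLine.trop_interior [Infinite K] (L : TorusLine K m)
    (hQ : Function.Injective L.Q) :
    trop L.interior = ⋃ i : Fin (m + 1), (ray i : Set (Fin m → ℝ)) := by
  refine Set.Subset.antisymm (fun y hy => ?_) (Set.iUnion_subset (L.ray_subset_trop hQ))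
  set Y : Fin (m + 1) → ℝ := Fin.cons 0 y with hY
  obtain ⟨a, -, ha⟩ := Finset.exists_min_image Finset.univ Y Finset.univ_nonempty
  obtain ⟨i, hi⟩ : ∃ i, ∀ j, j ≠ i → Y j = Y a := by
    by_cases h : ∃ i, Y a < Y i
    · obtain ⟨i, hi⟩ := h
      refine ⟨i, fun j hj => ?_⟩
      by_contra hne
      exact hj (L.eq_of_mem_trop hQ hy
        (lt_of_le_of_ne (ha j (Finset.mem_univ _)) (Ne.symm hne)) hi)
    · push Not at h
      exact ⟨0, fun j _ => le_antisymm (h j) (ha j (Finset.mem_univ _))⟩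
  refine Set.mem_iUnion.2 ⟨i, mem_ray_iff.2 ?_⟩
  have h0 : Y 0 = 0 := rfl
  have hs : ∀ k : Fin m, Y k.succ = y k := fun k => rfl
  induction i using Fin.cases with
  | zero =>
    refine ⟨-Y a, ?_, ?_⟩
    · have := ha 0 (Finset.mem_univ _)
      rw [h0] at this
      linarith
    · ext k
      have := hi k.succ (Fin.succ_ne_zero k)
      rw [hs] at this
      simp [e, this]
  | succ k =>
    have ha0 : Y a = 0 := by rw [← hi 0 (Fin.succ_ne_zero k).symm, h0]
    refine ⟨y k, ?_, ?_⟩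
    · have := ha k.succ (Finset.mem_univ _)
      rw [ha0, hs] at this
      exact this
    · ext l
      by_cases hl : l = k
      · subst hl; simp [e]
      · have := hi l.succ (fun h => hl (Fin.succ_injective _ h))
        rw [ha0, hs] at this
        simp [e, this, hl]

end TropicalLine

/-! ### The fan of half-spaces `C_i` with a common lineality space -/

section TropicalFan

variable {K : Type*} [Field K] {M : Type*} [AddCommGroup M] {m : ℕ}

/-- A plane `W` needs `m + 1 ≥ 2`. For `m = 0` the vector `e_0` would be zero and the cone `C_0`
would degenerate. -/
theorem TorusLine.pos (L : TorusLine K m) : 0 < m := by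
  have h1 := Module.finrank_eq_card_basis L.b
  have h2 := Submodule.finrank_le L.W
  rw [h1, Module.finrank_fintype_fun_eq_card, Fintype.card_fin, Fintype.card_fin] at h2
  omega

theorem eq_of_e_eq_smul {i j : Fin (m + 1)} {t : ℝ} (ht : 0 ≤ t) (h : e ℝ i = t • e ℝ j) :
    i = j := by
  induction i using Fin.cases with
  | zero =>
    induction j using Fin.cases with
    | zero => rfl
    | succ l =>
      have := congrFun h l
      simp [e] at this
      linarith
  | succ k =>
    have := congrFun h k
    induction j using Fin.cases with
    | zero =>
      simp [e] at this
      linarith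
    | succ l =>
      by_contra hne
      have hkl : k ≠ l := fun h => hne (by rw [h])
      simp [e, hkl] at this

theorem e_ne_zero (hm : 0 < m) (i : Fin (m + 1)) : e ℝ i ≠ 0 := by
  intro h
  induction i using Fin.cases with
  | zero =>
    have := congrFun h ⟨0, hm⟩
    simp [e] at this
  | succ k =>
    have := congrFun h k
    simp [e] at this

theorem mem_tropCone_iff {H : Finset (M × (Fin m → ℤ))} {i : Fin (m + 1)} {w : H → ℝ} :
    w ∈ tropCone H i ↔ ∃ (n : M →+ ℝ) (t : ℝ), 0 ≤ t ∧ tropMap H (n, t • e ℝ i) = w := by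
  constructor
  · rintro ⟨⟨n, y⟩, hy, rfl⟩
    obtain ⟨t, ht, rfl⟩ := mem_ray_iff.1 (show y ∈ ray i from hy)
    exact ⟨n, t, ht, rfl⟩
  · rintro ⟨n, t, ht, rfl⟩
    exact ⟨(n, t • e ℝ i), mem_ray_iff.2 ⟨t, ht, rfl⟩, rfl⟩

/-- The linear space `φ(N_ℝ × 0)`, as a cone. -/
def linealityCone (H : Finset (M × (Fin m → ℤ))) : PointedCone ℝ (H → ℝ) :=
  PointedCone.map ((tropMap H).comp (LinearMap.inl ℝ (M →+ ℝ) (Fin m → ℝ))) ⊤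

theorem mem_linealityCone_iff {H : Finset (M × (Fin m → ℤ))} {w : H → ℝ} :
    w ∈ linealityCone H ↔ ∃ n : M →+ ℝ, tropMap H (n, 0) = w := by
  constructor
  · rintro ⟨n, -, rfl⟩
    exact ⟨n, rfl⟩
  · rintro ⟨n, rfl⟩
    exact ⟨n, trivial, rfl⟩

theorem linealityCone_le (H : Finset (M × (Fin m → ℤ))) (i : Fin (m + 1)) :
    linealityCone H ≤ tropCone H i := by
  intro w hw
  obtain ⟨n, rfl⟩ := mem_linealityCone_iff.1 hw
  exact mem_tropCone_iff.2 ⟨n, 0, le_rfl, by rw [zero_smul]⟩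

theorem tropCone_le_iff {H : Finset (M × (Fin m → ℤ))} (hφ : Function.Injective (tropMap H))
    {i j : Fin (m + 1)} : tropCone H i ≤ tropCone H j ↔ i = j := by
  refine ⟨fun h => ?_, fun h => h ▸ le_rfl⟩
  obtain ⟨n, t, ht, hw⟩ := mem_tropCone_iff.1
    (h (mem_tropCone_iff.2 ⟨0, 1, zero_le_one, rfl⟩))
  have := congrArg Prod.snd (hφ hw)
  simp only [one_smul] at this
  exact eq_of_e_eq_smul ht this.symm

theorem tropCone_inf_tropCone {H : Finset (M × (Fin m → ℤ))}
    (hφ : Function.Injective (tropMap H)) {i j : Fin (m + 1)} (hij : i ≠ j) :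
    tropCone H i ⊓ tropCone H j = linealityCone H := by
  refine le_antisymm (fun w hw => ?_) (le_inf (linealityCone_le H i) (linealityCone_le H j))
  obtain ⟨n, t, ht, rfl⟩ := mem_tropCone_iff.1 hw.1
  obtain ⟨n', t', ht', hw'⟩ := mem_tropCone_iff.1 hw.2
  have h2 := congrArg Prod.snd (hφ hw')
  simp only at h2
  rcases ht.eq_or_lt with rfl | hpos
  · exact mem_linealityCone_iff.2 ⟨n, by rw [zero_smul]⟩
  · refine absurd (eq_of_e_eq_smul (t := t⁻¹ * t') (by positivity) ?_) hij
    rw [mul_smul, h2, smul_smul, inv_mul_cancel₀ hpos.ne', one_smul]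

/-- With `w` the space contains `-w`, and since their sum `0` lies in the face, so does `w`. -/
theorem linealityCone_le_of_isFaceOf {H : Finset (M × (Fin m → ℤ))} {c F : PointedCone ℝ (H → ℝ)}
    (hc : linealityCone H ≤ c) (hF : F.IsFaceOf c) : linealityCone H ≤ F := by
  intro w hw
  have hw' : -w ∈ linealityCone H := by
    obtain ⟨n, rfl⟩ := mem_linealityCone_iff.1 hw
    exact mem_linealityCone_iff.2 ⟨-n, by rw [← map_neg, Prod.neg_mk, neg_zero]⟩
  refine hF.mem_of_add_mem_left (hc hw) (hc hw') ?_
  rw [add_neg_cancel]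
  exact F.zero_mem

theorem linealityCone_isFaceOf {H : Finset (M × (Fin m → ℤ))}
    (hφ : Function.Injective (tropMap H)) (hm : 0 < m) (i : Fin (m + 1)) :
    (linealityCone H).IsFaceOf (tropCone H i) where
  le := linealityCone_le H i
  mem_of_smul_add_mem := by
    intro x y a hx hy ha hxy
    obtain ⟨n, t, ht, rfl⟩ := mem_tropCone_iff.1 hx
    obtain ⟨n', t', ht', rfl⟩ := mem_tropCone_iff.1 hy
    obtain ⟨n'', hw⟩ := mem_linealityCone_iff.1 hxy
    rw [← map_smul, ← map_add] at hw
    have h2 := congrArg Prod.snd (hφ hw)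
    simp only [Prod.snd_add, Prod.smul_snd, smul_smul, ← add_smul] at h2
    have h3 := (smul_eq_zero.1 h2.symm).resolve_right (e_ne_zero hm i)
    have h4 : t = 0 := by nlinarith [mul_nonneg ha.le ht]
    exact mem_linealityCone_iff.2 ⟨n, by rw [h4, zero_smul]⟩

/-- A half-space has no faces besides itself and its boundary: one point with `t > 0` generates the
rest modulo the lineality space. -/
theorem eq_of_isFaceOf_tropCone {H : Finset (M × (Fin m → ℤ))} {i : Fin (m + 1)}
    {F : PointedCone ℝ (H → ℝ)} (hF : F.IsFaceOf (tropCone H i)) :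
    F = tropCone H i ∨ F = linealityCone H := by
  have hle := linealityCone_le_of_isFaceOf (linealityCone_le H i) hF
  by_cases h : F ≤ linealityCone H
  · exact Or.inr (le_antisymm h hle)
  left
  refine le_antisymm hF.le fun w hw => ?_
  obtain ⟨x, hxF, hx⟩ := Set.not_subset.1 h
  obtain ⟨n, t, ht, rfl⟩ := mem_tropCone_iff.1 (hF.le hxF)
  have hpos : 0 < t := lt_of_le_of_ne ht fun h0 =>
    hx (mem_linealityCone_iff.2 ⟨n, by rw [← h0, zero_smul]⟩)
  obtain ⟨n', t', ht', rfl⟩ := mem_tropCone_iff.1 hw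
  -- The added lineality vector is chosen so that the sum is `t' / t` times the known point of the
  -- face.
  refine hF.mem_of_add_mem_left hw
    (mem_tropCone_iff.2 ⟨(t' / t) • n - n', 0, le_rfl, rfl⟩) ?_
  have : tropMap H (n', t' • e ℝ i) + tropMap H ((t' / t) • n - n', (0 : ℝ) • e ℝ i) =
      (t' / t) • tropMap H (n, t • e ℝ i) := by
    rw [← map_add, ← map_smul, Prod.mk_add_mk, Prod.smul_mk, zero_smul, add_zero, smul_smul,
      div_mul_cancel₀ _ hpos.ne', add_sub_cancel]
  rw [this]
  exact F.smul_mem (div_nonneg ht' ht) hxF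

/-- Needed to view a finite-dimensional linear space as a finitely generated cone. -/
theorem finite_real_nonneg : Module.Finite {c : ℝ // 0 ≤ c} ℝ := by
  refine ⟨⟨{1, -1}, eq_top_iff.2 fun x _ => ?_⟩⟩
  rcases le_total 0 x with hx | hx
  · have := Submodule.smul_mem (Submodule.span {c : ℝ // 0 ≤ c} (({1, -1} : Finset ℝ) : Set ℝ))
      ⟨x, hx⟩ (Submodule.subset_span (by simp : (1 : ℝ) ∈ _))
    simpa [← Nonneg.coe_smul] using this
  · have := Submodule.smul_mem (Submodule.span {c : ℝ // 0 ≤ c} (({1, -1} : Finset ℝ) : Set ℝ))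
      ⟨-x, neg_nonneg.2 hx⟩ (Submodule.subset_span (by simp : (-1 : ℝ) ∈ _))
    simpa [← Nonneg.coe_smul] using this

theorem linealityCone_fg [Module.Free ℤ M] [Module.Finite ℤ M]
    (H : Finset (M × (Fin m → ℤ))) : (linealityCone H).FG := by
  have := finite_real_nonneg
  have : Module.Finite {c : ℝ // 0 ≤ c} (M →+ ℝ) := Module.Finite.trans ℝ (M →+ ℝ)
  exact Submodule.FG.map _ Module.Finite.fg_top

theorem tropCone_fg [Module.Free ℤ M] [Module.Finite ℤ M] (H : Finset (M × (Fin m → ℤ)))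
    (i : Fin (m + 1)) : (tropCone H i).FG := by
  have : tropCone H i = linealityCone H ⊔ PointedCone.hull ℝ {tropMap H (0, e ℝ i)} := by
    refine le_antisymm (fun w hw => ?_) (sup_le (linealityCone_le H i) ?_)
    · obtain ⟨n, t, ht, rfl⟩ := mem_tropCone_iff.1 hw
      have : tropMap H (n, t • e ℝ i) = tropMap H (n, 0) + t • tropMap H (0, e ℝ i) := by
        rw [← map_smul, ← map_add]; simp
      rw [this]
      exact Submodule.add_mem_sup (mem_linealityCone_iff.2 ⟨n, rfl⟩)
        (PointedCone.smul_mem _ ht (Submodule.subset_span rfl))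
    · refine Submodule.span_le.2 (Set.singleton_subset_iff.2 ?_)
      exact mem_tropCone_iff.2 ⟨0, 1, zero_le_one, by rw [one_smul]⟩
  rw [this]
  exact (linealityCone_fg H).sup (Submodule.fg_span_singleton _)

theorem finrank_span_tropCone [Module.Free ℤ M] [Module.Finite ℤ M] {H : Finset (M × (Fin m → ℤ))}
    (hφ : Function.Injective (tropMap H)) (hm : 0 < m) (i : Fin (m + 1)) :
    Module.finrank ℝ (Submodule.span ℝ (tropCone H i : Set (H → ℝ))) =
      Module.finrank ℤ (M →+ ℤ) + 1 := by
  let g : ((M →+ ℝ) × ℝ) →ₗ[ℝ] (H → ℝ) := (tropMap H).comp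
    (LinearMap.prodMap LinearMap.id (LinearMap.toSpanSingleton ℝ _ (e ℝ i)))
  have hg : ∀ n t, g (n, t) = tropMap H (n, t • e ℝ i) := fun n t => rfl
  have hginj : Function.Injective g := by
    refine hφ.comp (Function.Injective.prodMap (f := id) (g := fun t : ℝ => t • e ℝ i)
      Function.injective_id (smul_left_injective ℝ (e_ne_zero hm i)))
  have hspan : Submodule.span ℝ (tropCone H i : Set (H → ℝ)) = LinearMap.range g := by
    refine le_antisymm (Submodule.span_le.2 fun w hw => ?_) ?_
    · obtain ⟨n, t, -, rfl⟩ := mem_tropCone_iff.1 hw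
      exact ⟨(n, t), rfl⟩
    · rintro _ ⟨⟨n, t⟩, rfl⟩
      have hmem : ∀ n t, 0 ≤ t → g (n, t) ∈ Submodule.span ℝ (tropCone H i : Set (H → ℝ)) :=
        fun n t ht => Submodule.subset_span (mem_tropCone_iff.2 ⟨n, t, ht, rfl⟩)
      rcases le_total 0 t with ht | ht
      · exact hmem n t ht
      · have := Submodule.neg_mem _ (hmem (-n) (-t) (neg_nonneg.2 ht))
        rwa [← map_neg, Prod.neg_mk, neg_neg, neg_neg] at this
  rw [hspan, LinearMap.finrank_range_of_inj hginj, Module.finrank_prod, finrank_realDual,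
    Module.finrank_self]

/-- The fan consisting of the cones `C_i` and of their common lineality space. -/
def tropFan (H : Finset (M × (Fin m → ℤ))) : Set (PointedCone ℝ (H → ℝ)) :=
  insert (linealityCone H) (Set.range (tropCone H))

theorem isFan_tropFan [Module.Free ℤ M] [Module.Finite ℤ M] {H : Finset (M × (Fin m → ℤ))}
    (hφ : Function.Injective (tropMap H)) (hm : 0 < m) : IsFan (tropFan H) where
  finite := (Set.finite_range _).insert _
  polyhedral := by
    rintro _ (rfl | ⟨i, rfl⟩)
    exacts [linealityCone_fg H, tropCone_fg H i]
  face_mem := by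
    rintro _ (rfl | ⟨i, rfl⟩) F hF
    · exact Or.inl (le_antisymm hF.le (linealityCone_le_of_isFaceOf le_rfl hF))
    · rcases eq_of_isFaceOf_tropCone hF with rfl | rfl
      exacts [Or.inr ⟨i, rfl⟩, Or.inl rfl]
  inter_face := by
    rintro _ (rfl | ⟨i, rfl⟩) _ (rfl | ⟨j, rfl⟩)
    · rw [inf_idem]
      exact ⟨.rfl, .rfl⟩
    · rw [inf_eq_left.2 (linealityCone_le H j)]
      exact ⟨.rfl, linealityCone_isFaceOf hφ hm j⟩
    · rw [inf_eq_right.2 (linealityCone_le H i)]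
      exact ⟨linealityCone_isFaceOf hφ hm i, .rfl⟩
    · by_cases hij : i = j
      · rw [hij, inf_idem]
        exact ⟨.rfl, .rfl⟩
      · rw [tropCone_inf_tropCone hφ hij]
        exact ⟨linealityCone_isFaceOf hφ hm i, linealityCone_isFaceOf hφ hm j⟩

theorem maximal_tropFan {H : Finset (M × (Fin m → ℤ))} (hφ : Function.Injective (tropMap H)) :
    {c | Maximal (· ∈ tropFan H) c} = Set.range (tropCone H) := by
  ext c
  constructor
  · rintro ⟨rfl | hc, hmax⟩
    -- A maximal lineality space would equal `C_0`, so it is in the range in any case.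
    · exact ⟨0, le_antisymm (hmax (Or.inr ⟨0, rfl⟩) (linealityCone_le H 0))
        (linealityCone_le H 0)⟩
    · exact hc
  · rintro ⟨i, rfl⟩
    refine ⟨Or.inr ⟨i, rfl⟩, ?_⟩
    rintro _ (rfl | ⟨j, rfl⟩) hle
    · exact linealityCone_le H i
    · rw [(tropCone_le_iff hφ).1 hle]

/-- A point with `t = 0` is on the boundary: a small move in the direction `-φ(0, e_i)` stays in the
affine span but leaves the cone. -/
theorem exists_pos_of_mem_intrinsicInterior {H : Finset (M × (Fin m → ℤ))}
    (hφ : Function.Injective (tropMap H)) (hm : 0 < m) {i : Fin (m + 1)} {w : H → ℝ}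
    (hw : w ∈ intrinsicInterior ℝ (tropCone H i : Set (H → ℝ))) :
    ∃ (n : M →+ ℝ) (t : ℝ), 0 < t ∧ tropMap H (n, t • e ℝ i) = w := by
  have hwC : w ∈ tropCone H i := intrinsicInterior_subset hw
  obtain ⟨n, t, ht, hnt⟩ := mem_tropCone_iff.1 hwC
  refine ⟨n, t, lt_of_le_of_ne ht ?_, hnt⟩
  rintro rfl
  obtain ⟨x, hx, hxw⟩ := mem_intrinsicInterior.1 hw
  have hv : w + tropMap H (0, e ℝ i) ∈ tropCone H i :=
    add_mem hwC (mem_tropCone_iff.2 ⟨0, 1, zero_le_one, by rw [one_smul]⟩)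
  have hline : ∀ r : ℝ, w + r • tropMap H (0, e ℝ i) ∈
      affineSpan ℝ (tropCone H i : Set (H → ℝ)) := by
    intro r
    have := AffineMap.lineMap_mem r (subset_affineSpan ℝ _ hwC) (subset_affineSpan ℝ _ hv)
    rw [AffineMap.lineMap_apply, vsub_eq_sub, add_sub_cancel_left, vadd_eq_add, add_comm] at this
    exact this
  let γ : ℝ → affineSpan ℝ (tropCone H i : Set (H → ℝ)) := fun r => ⟨_, hline r⟩
  have hγ : Continuous γ := by
    refine Continuous.subtype_mk ?_ _
    fun_prop
  have hγ0 : γ 0 = x := Subtype.ext (by simp [γ, hxw])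
  have hnhds : ∀ᶠ r in nhds (0 : ℝ), γ r ∈ interior
      ((↑) ⁻¹' (tropCone H i : Set (H → ℝ)) : Set (affineSpan ℝ (tropCone H i : Set (H → ℝ)))) :=
    hγ.continuousAt.eventually (by rw [hγ0]; exact isOpen_interior.mem_nhds hx)
  obtain ⟨ε, hε, hball⟩ := Metric.eventually_nhds_iff.1 hnhds
  -- By injectivity of `φ` this point has ray coefficient `-ε / 2 < 0`, which membership in the cone
  -- excludes.
  have hmem : w + (-(ε / 2)) • tropMap H (0, e ℝ i) ∈ tropCone H i :=
    interior_subset (s := ((↑) ⁻¹' (tropCone H i : Set (H → ℝ)) :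
      Set (affineSpan ℝ (tropCone H i : Set (H → ℝ))))) (hball (y := -(ε / 2)) (by
        rw [Real.dist_eq, sub_zero, abs_neg, abs_of_pos (by positivity)]; linarith))
  obtain ⟨n', t', ht', h'⟩ := mem_tropCone_iff.1 hmem
  rw [← hnt, ← map_smul, ← map_add] at h'
  have h2 := congrArg Prod.snd (hφ h')
  simp only [Prod.snd_add, Prod.smul_snd, ← add_smul] at h2
  have h3 := smul_left_injective ℝ (e_ne_zero hm i) h2
  linarith

end TropicalFan

/-! ### Constancy of the initial ideals of `J(L)` -/

section InitialIdealJ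

variable {K : Type*} [Field K] {M : Type*} [AddCommGroup M] {m : ℕ}

/-- The degree in `M × ℤ^m` of the exponent of an ordinary monomial. -/
def polyExponent (H : Finset (M × (Fin m → ℤ))) (n : H →₀ ℕ) : M × (Fin m → ℤ) :=
  exponentHom H fun h => (n h : ℤ)

theorem polyWeight_tropMap (H : Finset (M × (Fin m → ℤ))) (v : (M →+ ℝ) × (Fin m → ℝ))
    (n : H →₀ ℕ) : polyWeight (tropMap H v) n = pairing v (polyExponent H n) := by
  rw [polyExponent, ← laurentWeight_tropMap]
  simp [polyWeight, laurentWeight]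

theorem slice_polyToLaurent_component (H : Finset (M × (Fin m → ℤ))) (u u' : M)
    (F : MvPolynomial H K) [Decidable (u = u')] :
    slice H u' (polyToLaurent H (component (fun n => (polyExponent H n).1) u F)) =
      if u = u' then slice H u' (polyToLaurent H F) else 0 := by
  classical
  have hs : ∀ n c, polyToLaurent (K := K) H (AddMonoidAlgebra.single n c) =
    AddMonoidAlgebra.single (fun h => (n h : ℤ)) c := fun n c => polyToLaurent_monomial n c
  induction F using AddMonoidAlgebra.induction_linear with
  | zero => simp
  | add F G hF hG =>
    rw [map_add, map_add, map_add, hF, hG, map_add, map_add]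
    split_ifs <;> simp
  | single n c =>
    rw [component_single, hs, slice_single]
    by_cases h1 : (polyExponent H n).1 = u
    · rw [if_pos h1, hs, slice_single]
      change (if (polyExponent H n).1 = u' then _ else _) =
        if u = u' then (if (polyExponent H n).1 = u' then _ else _) else _
      rw [h1]
      split_ifs <;> rfl
    · rw [if_neg h1, map_zero, map_zero]
      change _ = if u = u' then (if (polyExponent H n).1 = u' then _ else _) else _
      split_ifs with h2 h3
      · exact absurd (h3.trans h2.symm) h1
      · rfl
      · rfl

/-- `J(L)` is homogeneous for the `M`-grading, since membership is tested slice by slice. -/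
theorem component_mem_idealJ (D : PolyhedralData M m) (L : TorusLine K m)
    (H : Finset (M × (Fin m → ℤ)))
    (hH : AddSubmonoid.closure (H : Set (M × (Fin m → ℤ))) = dualSemigroup D)
    (F : MvPolynomial H K) (hF : F ∈ idealJ D L H hH) (u : M) :
    component (fun n => (polyExponent H n).1) u F ∈ idealJ D L H hH := by
  classical
  rw [mem_idealJ_iff, laurentToFunctionField_eq_zero_iff] at hF ⊢
  intro u'
  rw [slice_polyToLaurent_component]
  split_ifs
  · exact hF u'
  · exact map_zero _

/-- Monomials of equal degree in `M` receive the same contribution from `n`, so only the order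
induced by `y` matters for a graded ideal. -/
theorem initialIdeal_idealJ_eq (D : PolyhedralData M m) (L : TorusLine K m)
    (H : Finset (M × (Fin m → ℤ)))
    (hH : AddSubmonoid.closure (H : Set (M × (Fin m → ℤ))) = dualSemigroup D)
    {w w' : H → ℝ} {n n' : M →+ ℝ} {y y' : Fin m → ℝ} (hw : tropMap H (n, y) = w)
    (hw' : tropMap H (n', y') = w')
    (hy : ∀ a b, laurentWeight y a ≤ laurentWeight y b ↔ laurentWeight y' a ≤ laurentWeight y' b) :
    initialIdeal (polyWeight w) (idealJ D L H hH) =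
      initialIdeal (polyWeight w') (idealJ D L H hH) := by
  subst hw hw'
  refine initialIdeal_eq_of_graded (fun n => (polyExponent H n).1) (fun a b hab => ?_)
    (component_mem_idealJ D L H hH)
  rw [polyWeight_tropMap, polyWeight_tropMap, polyWeight_tropMap, polyWeight_tropMap,
    pairing_eq, pairing_eq, pairing_eq, pairing_eq, hab, add_le_add_iff_left, add_le_add_iff_left]
  exact hy _ _

theorem laurentWeight_smul {ι : Type*} [Fintype ι] (t : ℝ) (y : ι → ℝ) (α : ι → ℤ) :
    laurentWeight (t • y) α = t * laurentWeight y α := by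
  simp [laurentWeight, Finset.mul_sum, mul_assoc]

/-- On the lineality space `y = 0`; in the relative interior of `C_i`, `y` is a positive multiple of
`e_i`. In both cases the induced order on exponents is fixed. -/
theorem initialIdeal_constant (D : PolyhedralData M m) (L : TorusLine K m)
    (H : Finset (M × (Fin m → ℤ)))
    (hH : AddSubmonoid.closure (H : Set (M × (Fin m → ℤ))) = dualSemigroup D)
    (hφ : Function.Injective (tropMap H)) {c : PointedCone ℝ (H → ℝ)} (hc : c ∈ tropFan H)
    {w w' : H → ℝ} (hw : w ∈ intrinsicInterior ℝ (c : Set (H → ℝ)))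
    (hw' : w' ∈ intrinsicInterior ℝ (c : Set (H → ℝ))) :
    initialIdeal (polyWeight w) (idealJ D L H hH) =
      initialIdeal (polyWeight w') (idealJ D L H hH) := by
  rcases hc with rfl | ⟨i, rfl⟩
  · obtain ⟨n, hn⟩ := mem_linealityCone_iff.1 (intrinsicInterior_subset hw)
    obtain ⟨n', hn'⟩ := mem_linealityCone_iff.1 (intrinsicInterior_subset hw')
    exact initialIdeal_idealJ_eq D L H hH hn hn' fun _ _ => Iff.rfl
  · obtain ⟨n, t, ht, hn⟩ := exists_pos_of_mem_intrinsicInterior hφ L.pos hw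
    obtain ⟨n', t', ht', hn'⟩ := exists_pos_of_mem_intrinsicInterior hφ L.pos hw'
    refine initialIdeal_idealJ_eq D L H hH hn hn' fun a b => ?_
    simp only [laurentWeight_smul]
    rw [mul_le_mul_iff_right₀ ht, mul_le_mul_iff_right₀ ht']

theorem iUnion_tropFan {H : Finset (M × (Fin m → ℤ))} :
    (⋃ c ∈ tropFan H, (c : Set (H → ℝ))) =
      tropMap H '' (Set.univ ×ˢ ⋃ i : Fin (m + 1), (ray i : Set (Fin m → ℝ))) := by
  ext w
  simp only [Set.mem_iUnion]
  constructor
  · rintro ⟨c, hc, hw⟩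
    obtain ⟨i, hi⟩ : ∃ i, w ∈ tropCone H i := by
      rcases hc with rfl | ⟨i, rfl⟩
      · exact ⟨0, linealityCone_le H 0 hw⟩
      · exact ⟨i, hw⟩
    obtain ⟨n, t, ht, rfl⟩ := mem_tropCone_iff.1 hi
    exact ⟨(n, t • e ℝ i), ⟨Set.mem_univ _, Set.mem_iUnion.2 ⟨i, mem_ray_iff.2 ⟨t, ht, rfl⟩⟩⟩, rfl⟩
  · rintro ⟨⟨n, y⟩, ⟨-, hy⟩, rfl⟩
    obtain ⟨i, hi⟩ := Set.mem_iUnion.1 hy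
    obtain ⟨t, ht, rfl⟩ := mem_ray_iff.1 hi
    exact ⟨tropCone H i, Or.inr ⟨i, rfl⟩, mem_tropCone_iff.2 ⟨n, t, ht, rfl⟩⟩

end InitialIdealJ

end SemiCanonical

/-! ### The main theorem -/

open SemiCanonical in
theorem mainTheorem8 {K : Type*} [Field K] [IsAlgClosed K]
    {M : Type*} [AddCommGroup M] [Module.Free ℤ M] [Module.Finite ℤ M] {m : ℕ}
    (D : PolyhedralData M m) (L : TorusLine K m) (H : Finset (M × (Fin m → ℤ)))
    (hH : AddSubmonoid.closure (H : Set (M × (Fin m → ℤ))) = dualSemigroup D) :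
    Function.Injective (tropMap H) ∧
    trop (interiorX D L H hH) = tropMap H '' (Set.univ ×ˢ trop L.interior) ∧
    (∃ (P : Submodule ℝ (H → ℝ)) (ψ : (Fin m → ℝ) →ₗ[ℝ] (H → ℝ)),
      Module.finrank ℝ P = Module.finrank ℤ (M →+ ℤ) ∧
      Function.Injective ψ ∧ Disjoint P (LinearMap.range ψ) ∧
      trop (interiorX D L H hH) = (P : Set (H → ℝ)) + ψ '' trop L.interior) ∧
    (Function.Injective L.Q →
      trop L.interior = ⋃ i : Fin (m + 1), (ray i : Set (Fin m → ℝ)) ∧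
      Function.Injective (tropCone H) ∧
      (∀ i, Module.finrank ℝ (Submodule.span ℝ (tropCone H i : Set (H → ℝ))) =
        Module.finrank ℤ (M →+ ℤ) + 1) ∧
      ∃ Φ : Set (PointedCone ℝ (H → ℝ)), IsFan Φ ∧
        (⋃ c ∈ Φ, (c : Set (H → ℝ))) = trop (interiorX D L H hH) ∧
        (∀ c ∈ Φ, ∀ w ∈ intrinsicInterior ℝ (c : Set (H → ℝ)),
          ∀ w' ∈ intrinsicInterior ℝ (c : Set (H → ℝ)),
          initialIdeal (polyWeight w) (idealJ D L H hH) =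
            initialIdeal (polyWeight w') (idealJ D L H hH)) ∧
        {c | Maximal (· ∈ Φ) c} = Set.range (tropCone H)) := by
  have hφ := tropMap_injective (exponentHom_surjective D H hH)
  refine ⟨hφ, trop_interiorX D L H hH, trop_eq_add D L H hH, fun hQ => ?_⟩
  refine ⟨L.trop_interior hQ, fun i j h => (tropCone_le_iff hφ).1 h.le,
    finrank_span_tropCone hφ L.pos, tropFan H, isFan_tropFan hφ L.pos, ?_,
    fun c hc w hw w' hw' => initialIdeal_constant D L H hH hφ hc hw hw', maximal_tropFan hφ⟩
  rw [trop_interiorX, L.trop_interior hQ, iUnion_tropFan]
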